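/- Let $A,B,C$ be complex vector spaces of dimension $m$, let $T\in A\otimes B\otimes C$, let $G_T\subset GL(A)\times GL(B)\times GL(C)$ be its symmetry group and let $\mathbb B_T$ be a Borel subgroup of $G_T$ (a maximal Zariski closed, connected, solvable subgroup). For a projective variety $X$, $\sigma_j(X)$ is the Zariski closure of the union of the spans of $j$ points of $X$; inclusions of linear spaces in $\sigma_j(X)$ mean inclusions in the affine cone over it. $\underline{\mathbf R}$ denotes border rank. Viability. A $\mathbb Z^{3}$-graded ideal $I\subset Sym(A^*)\otimes Sym(B^*)\otimes Sym(C^*)$ *arises from a border rank $r$ decomposition of $T$* if there are nonzero vectors $a_i(n)\in A$, $b_i(n)\in B$, $c_i(n)\in C$ ($1\le i\le r$, $n\in\mathbb N$) with $T=\lim_{n\to\infty}\sum_{i=1}^r a_i(n)\otimes b_i(n)\otimes c_i(n)$ such that, for every $(s,t,u)$, the component $I_{stu}\subset S^sA^*\otimes S^tB^*\otimes S^uC^*$ is the limit, in the Grassmannian, of the components of degree $(s,t,u)$ of the multigraded ideals of the sets of points $\{([a_i(n)],[b_i(n)],[c_i(n)])\}_{i=1}^r\subset\mathbb PA\times\mathbb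 PB\times\mathbb PC$. A linear subspace $E_{stu}\subset S^sA\otimes S^tB\otimes S^uC$ is *viable* if $\dim E_{stu}=r$ and $E_{stu}=I_{stu}^{\perp}$ for such an ideal $I$. **Flag conditions.** (1) If $E_{110}\subset A\otimes B$ is viable, then there is a complete flag $F_1\subset F_2\subset\cdots\subset F_r=E_{110}$, $\dim F_j=j$, such that for all $1\le j\le r$: $F_j\subset\sigma_j(Seg(\mathbb PA\times\mathbb PB))$, and $\underline{\mathbf R}(T_j)\le j$ for every tensor $T_j\in A\otimes B\otimes\mathbb C^j$ with $T_j(\mathbb C^{j*})=F_j$. If $E_{110}$ is $\mathbb B_T$-fixed, then the flag may moreover be chosen so that every $F_j$ is $\mathbb B_T$-fixed. (2) Let $s,t,u\ge 0$. If $E_{stu}$ is viable, then there are a complete flag $F_1\subset F_2\subset\cdots\subset F_r=E_{stu}$, $\dim F_j=j$, and complete flags $A_1\subset\cdots\subset A_m=A$, $B_1\subset\cdots\subset B_m=B$, $C_1\subset\cdots\subset C_m=C$, such that $$F_j\subset\sigma_j\bigl(Seg(v_s(\mathbb PA)\times v_t(\mathbb PB)\times v_u(\mathbb PC))\bigr)\quad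 (1\le j\le r),\qquad F_j\subset E_{stu}\cap S^sA_j\otimes S^tB_j\otimes S^uC_j\quad (1\le j\le \min(m,r)).$$ Here $v_s([a])=[a^s]$. If $E_{stu}$ is $\mathbb B_T$-fixed, then the flag $F_1\subset\cdots\subset F_r$ may moreover be chosen so that every $F_j$ is $\mathbb B_T$-fixed. -/

import Mathlib

open Filter Topology

noncomputable section

namespace FlagCond

/-! The spaces `A`, `B`, `C` are three copies of `ℂ^m`, numbered by `p = 0, 1, 2 : Fin 3`.
A multidegree is `d = (s, t, u) : Fin 3 → ℕ`. -/

/-- Indices of tensors in `A^{⊗ s} ⊗ B^{⊗ t} ⊗ C^{⊗ u}`, where `d = (s, t, u)`. -/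
abbrev Idx (m : ℕ) (d : Fin 3 → ℕ) : Type := (p : Fin 3) → Fin (d p) → Fin m

/-- The space `A^{⊗ s} ⊗ B^{⊗ t} ⊗ C^{⊗ u}`, in coordinates. In particular `Tens m ![1, 1, 1]` is
`A ⊗ B ⊗ C` and `Tens m ![1, 1, 0]` is `A ⊗ B`. -/
abbrev Tens (m : ℕ) (d : Fin 3 → ℕ) : Type := Idx m d → ℂ

/-- A triple `x = (a, b, c)` of vectors in `A × B × C`. -/
abbrev Point (m : ℕ) : Type := Fin 3 → Fin m → ℂ

/-- The tensor `a^{⊗ s} ⊗ b^{⊗ t} ⊗ c^{⊗ u}` of the triple `x = (a, b, c)`. -/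
def power {m : ℕ} (d : Fin 3 → ℕ) (x : Point m) : Tens m d :=
  fun i => ∏ p, ∏ q, x p (i p q)

/-- For subspaces `A'`, `B'`, `C'` of `A`, `B`, `C`, the space `S^s A' ⊗ S^t B' ⊗ S^u C'` of
(partially) symmetric tensors; it is spanned by the `a^s ⊗ b^t ⊗ c^u`. -/
def symTens {m : ℕ} (W : Fin 3 → Submodule ℂ (Fin m → ℂ)) (d : Fin 3 → ℕ) :
    Submodule ℂ (Tens m d) :=
  Submodule.span ℂ {X | ∃ x : Point m, (∀ p, x p ∈ W p) ∧ X = power d x}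

/-! ### Secant varieties and border rank -/

/-- The affine cone over the Segre-Veronese variety
`Seg(v_s(ℙA) × v_t(ℙB) × v_u(ℙC))`, with the origin. -/
def segreVeroneseCone (m : ℕ) (d : Fin 3 → ℕ) : Set (Tens m d) :=
  {X | ∃ (z : ℂ) (x : Point m), X = z • power d x}

/-- Zariski closure of a subset of an affine space. -/
def zariskiClosure {ι : Type} (S : Set (ι → ℂ)) : Set (ι → ℂ) :=
  {v | ∀ f : MvPolynomial ι ℂ, (∀ w ∈ S, MvPolynomial.eval w f = 0) → MvPolynomial.eval v f = 0}

/-- The affine cone over the secant variety `σ_j(X)`, where `S` is the affine cone over `X`. -/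
def secantCone {ι : Type} (S : Set (ι → ℂ)) (j : ℕ) : Set (ι → ℂ) :=
  zariskiClosure {v | ∃ y : Fin j → (ι → ℂ), (∀ i, y i ∈ S) ∧ v = ∑ i, y i}

/-- A tensor in `A ⊗ B ⊗ ℂ^n`, given by its `n` slices in `A ⊗ B`, has border rank at most `k`:
it is a limit of sums of `k` tensors `a ⊗ b ⊗ c` (some of which may vanish). -/
def BorderRankLE {m n : ℕ} (t : Fin n → Tens m ![1, 1, 0]) (k : ℕ) : Prop :=
  t ∈ closure {t' : Fin n → Tens m ![1, 1, 0] |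
    ∃ (x : Fin k → Point m) (c : Fin k → Fin n → ℂ),
      t' = ∑ i, fun l => c i l • power ![1, 1, 0] (x i)}

/-! ### The polynomial ring `Sym(A^* ⊕ B^* ⊕ C^*)` and its multigraded ideals -/

/-- The homogeneous coordinate ring `Sym(A^*) ⊗ Sym(B^*) ⊗ Sym(C^*)`; the variable `(p, i)` is
the `i`-th coordinate on the `p`-th of the spaces `A`, `B`, `C`. -/
abbrev CoordRing (m : ℕ) : Type := MvPolynomial (Fin 3 × Fin m) ℂ

/-- The multidegrees of the variables. -/
def wt (m : ℕ) : Fin 3 × Fin m → (Fin 3 → ℕ) := fun v => Pi.single v.1 1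

/-- The component `S^s A^* ⊗ S^t B^* ⊗ S^u C^*` of the coordinate ring. -/
def component (m : ℕ) (d : Fin 3 → ℕ) : Submodule ℂ (CoordRing m) :=
  MvPolynomial.weightedHomogeneousSubmodule ℂ (wt m) d

/-- The component `I_{stu}` of an ideal. -/
def idealPart {m : ℕ} (I : Ideal (CoordRing m)) (d : Fin 3 → ℕ) : Submodule ℂ (CoordRing m) :=
  I.restrictScalars ℂ ⊓ component m d

/-- An ideal is multigraded if it contains the multihomogeneous components of its elements. -/
def IsMultigraded {m : ℕ} (I : Ideal (CoordRing m)) : Prop :=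
  ∀ f ∈ I, ∀ d : Fin 3 → ℕ, MvPolynomial.weightedHomogeneousComponent (wt m) d f ∈ I

/-- The value of a polynomial at `x = (a, b, c)`. -/
def evalAt {m : ℕ} (x : Point m) (f : CoordRing m) : ℂ :=
  MvPolynomial.eval (fun v => x v.1 v.2) f

/-- The multigraded ideal of the points `([a_i], [b_i], [c_i])` of `ℙA × ℙB × ℙC`. -/
def pointsIdeal {m r : ℕ} (x : Fin r → Point m) : Ideal (CoordRing m) :=
  Ideal.span {f | (∃ d, f ∈ component m d) ∧ ∀ i, evalAt (x i) f = 0}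

/-- The polynomial of degree `(s, t, u)` that is represented by a tensor in
`A^{* ⊗ s} ⊗ B^{* ⊗ t} ⊗ C^{* ⊗ u}`. -/
def toPoly {m : ℕ} {d : Fin 3 → ℕ} (f : Tens m d) : CoordRing m :=
  ∑ i, MvPolynomial.C (f i) * ∏ p, ∏ q, MvPolynomial.X (p, i p q)

/-- `E_{stu} = I_{stu}^⊥ ⊆ S^s A ⊗ S^t B ⊗ S^u C`. An element of `I_{stu}` is paired with a
symmetric tensor through any tensor that represents it. -/
def perp {m : ℕ} (I : Ideal (CoordRing m)) (d : Fin 3 → ℕ) : Submodule ℂ (Tens m d) where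
  carrier := {X | X ∈ symTens (fun _ => (⊤ : Submodule ℂ (Fin m → ℂ))) d ∧
    ∀ f : Tens m d, toPoly f ∈ I → ∑ i, f i * X i = 0}
  zero_mem' := ⟨Submodule.zero_mem _, fun f _ => by simp⟩
  add_mem' := by
    rintro X Y ⟨hX, hX'⟩ ⟨hY, hY'⟩
    refine ⟨Submodule.add_mem _ hX hY, fun f hf => ?_⟩
    simp [mul_add, Finset.sum_add_distrib, hX' f hf, hY' f hf]
  smul_mem' := by
    rintro z X ⟨hX, hX'⟩
    refine ⟨Submodule.smul_mem _ z hX, fun f hf => ?_⟩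
    have h : ∑ i, f i * (z • X) i = z * ∑ i, f i * X i := by
      rw [Finset.mul_sum]
      exact Finset.sum_congr rfl fun i _ => by simp [mul_left_comm]
    rw [h, hX' f hf, mul_zero]

/-! ### Viability -/

/-- Convergence in a Grassmannian, for subspaces of one component of the coordinate ring (a
finite-dimensional space): the dimensions agree in the end, and every element of the limit is a
limit of elements (coefficient by coefficient). -/
def GrassmannTendsto {m : ℕ} (W : ℕ → Submodule ℂ (CoordRing m))
    (L : Submodule ℂ (CoordRing m)) : Prop :=
  (∀ᶠ n in atTop, Module.finrank ℂ (W n) = Module.finrank ℂ L) ∧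
  ∀ f ∈ L, ∃ g : ℕ → CoordRing m, (∀ n, g n ∈ W n) ∧
    ∀ e, Tendsto (fun n => MvPolynomial.coeff e (g n)) atTop (𝓝 (MvPolynomial.coeff e f))

/-- The multigraded ideal `I` arises from a border rank `r` decomposition of `T`: there are
`r`-tuples of rank one tensors whose sums converge to `T`, such that `I` is, degree by degree,
the limit of the ideals of the corresponding `r`-tuples of points of `ℙA × ℙB × ℙC`. -/
def IsViableIdeal {m : ℕ} (r : ℕ) (T : Tens m ![1, 1, 1]) (I : Ideal (CoordRing m)) : Prop :=
  IsMultigraded I ∧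
  ∃ x : ℕ → Fin r → Point m,
    (∀ n i p, x n i p ≠ 0) ∧
    Tendsto (fun n => ∑ i, power ![1, 1, 1] (x n i)) atTop (𝓝 T) ∧
    ∀ d, GrassmannTendsto (fun n => idealPart (pointsIdeal (x n)) d) (idealPart I d)

/-- An `r`-dimensional space `E ⊆ S^s A ⊗ S^t B ⊗ S^u C` is viable if it is `I_{stu}^⊥` for an
ideal `I` that arises from a border rank `r` decomposition of `T`. -/
def IsViable {m : ℕ} (r : ℕ) (T : Tens m ![1, 1, 1]) (d : Fin 3 → ℕ)
    (E : Submodule ℂ (Tens m d)) : Prop :=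
  Module.finrank ℂ E = r ∧ ∃ I : Ideal (CoordRing m), IsViableIdeal r T I ∧ E = perp I d

/-! ### Groups -/

/-- `GL(A) × GL(B) × GL(C)`. -/
abbrev GL3 (m : ℕ) : Type := Fin 3 → Matrix.GeneralLinearGroup (Fin m) ℂ

/-- The matrix of the action of `g` on `A^{⊗ s} ⊗ B^{⊗ t} ⊗ C^{⊗ u}`. -/
def actMatrix {m : ℕ} (d : Fin 3 → ℕ) (g : GL3 m) : Matrix (Idx m d) (Idx m d) ℂ :=
  Matrix.of fun i j => ∏ p, ∏ q, (g p : Matrix (Fin m) (Fin m) ℂ) (i p q) (j p q)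

/-- The action of `g = (g₁, g₂, g₃)` on `A^{⊗ s} ⊗ B^{⊗ t} ⊗ C^{⊗ u}`. -/
def act {m : ℕ} (d : Fin 3 → ℕ) (g : GL3 m) : Tens m d →ₗ[ℂ] Tens m d :=
  (actMatrix d g).mulVecLin

theorem actMatrix_one {m : ℕ} (d : Fin 3 → ℕ) : actMatrix d (1 : GL3 m) = 1 := by
  ext i j
  have h1 : actMatrix d (1 : GL3 m) i j =
      ∏ p, ∏ q, (1 : Matrix (Fin m) (Fin m) ℂ) (i p q) (j p q) := rfl
  rw [h1]
  by_cases h : i = j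
  · subst h
    simp
  · rw [Matrix.one_apply_ne h]
    obtain ⟨p, hp⟩ := Function.ne_iff.mp h
    obtain ⟨q, hq⟩ := Function.ne_iff.mp hp
    refine Finset.prod_eq_zero (Finset.mem_univ p) ?_
    exact Finset.prod_eq_zero (Finset.mem_univ q) (Matrix.one_apply_ne hq)

theorem actMatrix_mul {m : ℕ} (d : Fin 3 → ℕ) (g h : GL3 m) :
    actMatrix d (g * h) = actMatrix d g * actMatrix d h := by
  ext i j
  have h1 : ∀ p, ∏ q, ((g * h) p : Matrix (Fin m) (Fin m) ℂ) (i p q) (j p q) =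
      ∑ k : Fin (d p) → Fin m, ∏ q, (g p : Matrix (Fin m) (Fin m) ℂ) (i p q) (k q) *
        (h p : Matrix (Fin m) (Fin m) ℂ) (k q) (j p q) := by
    intro p
    simp only [Pi.mul_apply, Units.val_mul, Matrix.mul_apply]
    rw [Finset.prod_univ_sum, Fintype.piFinset_univ]
  simp only [actMatrix, Matrix.of_apply, Matrix.mul_apply, h1]
  rw [Finset.prod_univ_sum, Fintype.piFinset_univ]
  simp only [Finset.prod_mul_distrib]

theorem act_one {m : ℕ} (d : Fin 3 → ℕ) (X : Tens m d) : act d (1 : GL3 m) X = X := by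
  simp [act, actMatrix_one]

theorem act_mul {m : ℕ} (d : Fin 3 → ℕ) (g h : GL3 m) (X : Tens m d) :
    act d (g * h) X = act d g (act d h X) := by
  simp [act, actMatrix_mul, Matrix.mulVec_mulVec]

/-- The symmetry group `G_T` of a tensor. -/
def symmetryGroup {m : ℕ} (T : Tens m ![1, 1, 1]) : Subgroup (GL3 m) where
  carrier := {g | act ![1, 1, 1] g T = T}
  one_mem' := act_one _ T
  mul_mem' := by
    intro g h hg hh
    simp only [Set.mem_ofPred_eq] at hg hh ⊢
    rw [act_mul, hh, hg]
  inv_mem' := by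
    intro g hg
    simp only [Set.mem_ofPred_eq] at hg ⊢
    conv_lhs => rw [← hg]
    rw [← act_mul, inv_mul_cancel, act_one]

/-- The matrix entries of an element of `GL(A) × GL(B) × GL(C)`. -/
def entries {m : ℕ} (g : GL3 m) : Fin 3 × Fin m × Fin m → ℂ :=
  fun v => (g v.1 : Matrix (Fin m) (Fin m) ℂ) v.2.1 v.2.2

/-- Zariski closed subsets of `GL(A) × GL(B) × GL(C)`: zero sets of polynomials in the entries. -/
def IsZariskiClosed {m : ℕ} (Z : Set (GL3 m)) : Prop :=
  ∃ S : Set (MvPolynomial (Fin 3 × Fin m × Fin m) ℂ),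
    Z = {g | ∀ f ∈ S, MvPolynomial.eval (entries g) f = 0}

/-- Connectedness in the Zariski topology (of a nonempty set). -/
def IsZariskiConnected {m : ℕ} (H : Set (GL3 m)) : Prop :=
  ∀ Z Z' : Set (GL3 m), IsZariskiClosed Z → IsZariskiClosed Z' →
    H ⊆ Z ∪ Z' → H ∩ (Z ∩ Z') = ∅ → H ⊆ Z ∨ H ⊆ Z'

/-- Closed connected solvable subgroups of an algebraic group `G`. -/
def IsClosedConnectedSolvable {m : ℕ} (G H : Subgroup (GL3 m)) : Prop :=
  H ≤ G ∧ IsZariskiClosed (H : Set (GL3 m)) ∧ IsZariskiConnected (H : Set (GL3 m)) ∧ Group.IsSolvable H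

/-- Borel subgroups of `G`: the maximal closed connected solvable subgroups. -/
def IsBorelSubgroup {m : ℕ} (G H : Subgroup (GL3 m)) : Prop :=
  IsClosedConnectedSolvable G H ∧
  ∀ K : Subgroup (GL3 m), IsClosedConnectedSolvable G K → H ≤ K → K = H

/-- A subspace is fixed by a group: `g · F = F` for all its elements `g`. -/
def IsFixed {m : ℕ} {d : Fin 3 → ℕ} (H : Subgroup (GL3 m)) (F : Submodule ℂ (Tens m d)) : Prop :=
  ∀ g ∈ H, F.map (act d g) = F

/-! ### Flags -/

/-- `F 1 ⊂ F 2 ⊂ ⋯ ⊂ F n = E` is a complete flag in the `n`-dimensional space `E`, where `F j` has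
dimension `j` (and `F 0 = 0`). -/
def IsCompleteFlag {V : Type} [AddCommGroup V] [Module ℂ V] (E : Submodule ℂ V) (n : ℕ)
    (F : ℕ → Submodule ℂ V) : Prop :=
  (∀ j ≤ n, Module.finrank ℂ (F j) = j) ∧ (∀ j < n, F j ≤ F (j + 1)) ∧ F n = E

end FlagCond

end

/-!
Suppose that `E` is viable. For large `n`, the powers `a^s ⊗ b^t ⊗ c^u` of the `r` points
`x n i` of the border rank decomposition are linearly independent, and `E` is the limit of their
spans: both are a count of dimensions, through the duality between tensors and polynomials
(`perp_pointsIdeal`, `finrank_perp_eq`, `mem_perp_of_tendsto`). The spans of the first `j` powers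
form a flag, and flags of `A`, `B`, `C` can be chosen so that their `j`-th members contain the first
`j` points. Complete flags are the flags of orthonormal frames, and these form compact sets, so that
a subsequence of these flags converges (`IsViable.exists_secantFrames`). The conditions on the flags
are closed, and hold in the limit. They are stated in the form `IsSecantFlag`: every tuple of vectors
of `F j` is a limit of tuples in the spans of `j` powers. This gives both the border rank condition
and the containment in the secant variety, as a Euclidean closure lies in the Zariski closure.

It remains to choose the flag fixed by the Borel subgroup, if `E` is. The set of flags with the
required properties is compact and stable under the group, and the fixed point theorem of Borel
applies. The proof of this theorem given here uses no algebraic geometry of flag varieties. It is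
enough to find fixed lines in compact stable sets of lines of a representation `V ⧸ N`, one subspace
of the flag after the other (`exists_fixed_frame`). By the Lie–Kolchin theorem there is a
semi-invariant linear form `l` on `V ⧸ N`. If it vanishes on some of the lines, one goes on with those
lines, in the kernel of `l`. If not, every other linear form divided by `l` is a bounded function on
the set of lines, which gives a bounded regular function on the group along each orbit. A bounded
regular function on a connected affine algebraic group is constant (`finite_range_of_bounded`), so
all the lines are fixed (`exists_fixed_line`).

Of the connectedness of a group, only one consequence is used: a regular function with finitely many
values is constant (`RegularFunctions.IsConnected`). This property passes to commutator subgroups,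
and the Lie–Kolchin theorem (`exists_eigenvector_of_solvable`) follows from it.
-/

namespace FlagCond

open scoped commutatorElement

/-! ### Regular functions on a group and the Lie–Kolchin theorem -/

/-- An algebra of "regular" complex functions on a group, stable under the operations of the group
that the arguments below substitute into a regular function. -/
structure RegularFunctions (G : Type*) [Group G] where
  /-- The underlying algebra of functions. -/
  functions : Subalgebra ℂ (G → ℂ)
  mul_left_mem : ∀ f ∈ functions, ∀ a, (fun x => f (a * x)) ∈ functions
  comp_inv_mem : ∀ f ∈ functions, (fun x => f x⁻¹) ∈ functions
  conj_mem : ∀ f ∈ functions, ∀ y, (fun x => f (x⁻¹ * y * x)) ∈ functions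

namespace RegularFunctions

variable {G : Type*} [Group G] (R : RegularFunctions G)

theorem mul_right_mem {f : G → ℂ} (hf : f ∈ R.functions) (a : G) :
    (fun x => f (x * a)) ∈ R.functions := by
  simpa using R.comp_inv_mem _ (R.mul_left_mem _ (R.comp_inv_mem f hf) a⁻¹)

theorem commutator_mem {f : G → ℂ} (hf : f ∈ R.functions) (y : G) :
    (fun x => f ⁅x, y⁆) ∈ R.functions := by
  simpa [commutatorElement_def] using R.comp_inv_mem _ (R.conj_mem _ (R.mul_right_mem hf y⁻¹) y)

/-- Connectedness of a subgroup, as the regular functions see it: a regular function that takes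
only finitely many values on the subgroup is constant there. -/
def IsConnected (H : Subgroup G) : Prop :=
  ∀ f ∈ R.functions, (f '' (H : Set G)).Finite → ∀ h ∈ H, f h = f 1

variable {R} in
/-- The commutator subgroup of a connected group is connected: in a product of commutators
`⁅x, y⁆`, the entries `x` can be moved to `1` one at a time. -/
theorem IsConnected.commutator {H : Subgroup G} (hH : R.IsConnected H) :
    R.IsConnected ⁅H, H⁆ := by
  suffices h : ∀ w ∈ ⁅H, H⁆, ∀ f ∈ R.functions, (f '' (⁅H, H⁆ : Subgroup G)).Finite → f w = f 1 from
    fun f hf hfin w hw => h w hw f hf hfin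
  intro w hw
  rw [Subgroup.commutator_def] at hw
  induction hw using Subgroup.closure_induction with
  | mem w hw =>
    obtain ⟨x, hx, y, hy, rfl⟩ := hw
    intro f hf hfin
    have := hH _ (R.commutator_mem hf y) (hfin.subset ?_) x hx
    · simpa using this
    · rintro _ ⟨z, hz, rfl⟩
      exact ⟨_, Subgroup.commutator_mem_commutator hz hy, rfl⟩
  | one => exact fun _ _ _ => rfl
  | mul a b ha hb iha ihb =>
    intro f hf hfin
    rw [← Subgroup.commutator_def] at ha
    rw [← iha f hf hfin]
    have := ihb _ (R.mul_left_mem f hf a) (hfin.subset ?_)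
    · simpa using this
    · rintro _ ⟨z, hz, rfl⟩
      exact ⟨_, mul_mem ha hz, rfl⟩
  | inv a ha iha =>
    intro f hf hfin
    have := iha _ (R.comp_inv_mem f hf) (hfin.subset ?_)
    · simpa using this
    · rintro _ ⟨z, hz, rfl⟩
      exact ⟨_, inv_mem hz, rfl⟩

variable {V : Type*} [AddCommGroup V] [Module ℂ V]

/-- A representation is rational if its matrix coefficients are regular functions. -/
def IsRational (ρ : G →* Module.End ℂ V) : Prop :=
  ∀ (l : Module.Dual ℂ V) (v : V), (fun g => l (ρ g v)) ∈ R.functions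

end RegularFunctions

theorem exists_dual_apply_eq_one {V : Type*} [AddCommGroup V] [Module ℂ V] {N : Submodule ℂ V}
    {v : V} (hv : v ∉ N) : ∃ l : Module.Dual ℂ V, l v = 1 ∧ ∀ w ∈ N, l w = 0 := by
  obtain ⟨l, hl, hN⟩ := Submodule.exists_le_ker_of_notMem hv
  refine ⟨(l v)⁻¹ • l, by simp [hl], fun w hw => ?_⟩
  have : l w = 0 := hN hw
  simp [this]

section Eigenvectors

variable {V : Type*} [AddCommGroup V] [Module ℂ V] [FiniteDimensional ℂ V]

theorem exists_eigenvector_mem (f : Module.End ℂ V) {U : Submodule ℂ V} (hU : U ≠ ⊥)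
    (hf : ∀ v ∈ U, f v ∈ U) : ∃ c : ℂ, ∃ v ∈ U, v ≠ 0 ∧ f v = c • v := by
  have : Nontrivial U := Submodule.nontrivial_iff_ne_bot.mpr hU
  obtain ⟨c, hc⟩ := Module.End.exists_eigenvalue (f.restrict hf)
  obtain ⟨v, hv⟩ := hc.exists_hasEigenvector
  refine ⟨c, v, v.2, fun h => hv.2 (Subtype.ext h), ?_⟩
  simpa using congrArg Subtype.val hv.apply_eq_smul

theorem exists_common_eigenvector_of_commute {ι : Type*} (f : ι → Module.End ℂ V)
    (U : Submodule ℂ V) (hU : U ≠ ⊥) (hf : ∀ i, ∀ v ∈ U, f i v ∈ U)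
    (hc : ∀ i j, ∀ v ∈ U, f i (f j v) = f j (f i v)) :
    ∃ v ∈ U, v ≠ 0 ∧ ∀ i, ∃ c : ℂ, f i v = c • v := by
  induction h : Module.finrank ℂ U using Nat.strong_induction_on generalizing U with
  | _ n ih =>
    subst h
    by_cases hs : ∀ i, ∃ c : ℂ, ∀ v ∈ U, f i v = c • v
    · obtain ⟨v, hv, hv0⟩ := Submodule.exists_mem_ne_zero_of_ne_bot hU
      exact ⟨v, hv, hv0, fun i => (hs i).imp fun c hc => hc v hv⟩
    · push Not at hs
      obtain ⟨i, hi⟩ := hs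
      obtain ⟨c, v, hv, hv0, hcv⟩ := exists_eigenvector_mem (f i) hU (hf i)
      obtain ⟨w, hw, hcw⟩ := hi c
      let U' := U ⊓ LinearMap.ker (f i - c • LinearMap.id)
      have hmem : ∀ u, u ∈ U' ↔ u ∈ U ∧ f i u = c • u := fun u => by
        simp [U', sub_eq_zero]
      have hlt : U' < U :=
        lt_of_le_of_ne inf_le_left fun h => hcw (((hmem w).1 (h ▸ hw)).2)
      obtain ⟨u, hu, hu0, hcu⟩ := ih _ (Submodule.finrank_lt_finrank_of_lt hlt) U'
        (fun h => hv0 (by simpa [h] using (hmem v).2 ⟨hv, hcv⟩))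
        (fun j u hu => (hmem _).2 ⟨hf j u ((hmem u).1 hu).1, by
          rw [hc i j u ((hmem u).1 hu).1, ((hmem u).1 hu).2, map_smul]⟩)
        (fun j k u hu => hc j k u ((hmem u).1 hu).1) rfl
      exact ⟨u, ((hmem u).1 hu).1, hu0, hcu⟩

variable {G : Type*} [Group G] (R : RegularFunctions G) (ρ : G →* Module.End ℂ V)

/-- The Lie–Kolchin theorem: a connected solvable group has an eigenvector in every nonzero
stable subspace of a rational representation. Conjugation by `H` permutes the finitely many
eigenvalues of an element of the commutator subgroup, so by connectedness it fixes the weights of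
the commutator subgroup, and `H` acts on a weight space `U`. There a commutator `⁅x, y⁆` acts by a
scalar which is a quotient of two eigenvalues of `y`, so by connectedness it is `1`, and `H` acts on
`U` by commuting endomorphisms. -/
theorem exists_eigenvector_of_solvable (hρ : R.IsRational ρ) (n : ℕ) (H : Subgroup G)
    (hH : R.IsConnected H) (hn : (fun K : Subgroup G => ⁅K, K⁆)^[n] H = ⊥)
    (W : Submodule ℂ V) (hW : W ≠ ⊥) (hHW : ∀ h ∈ H, ∀ v ∈ W, ρ h v ∈ W) :
    ∃ v ∈ W, v ≠ 0 ∧ ∀ h ∈ H, ∃ c : ℂ, ρ h v = c • v := by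
  induction n generalizing H W with
  | zero =>
    obtain ⟨v, hv, hv0⟩ := Submodule.exists_mem_ne_zero_of_ne_bot hW
    refine ⟨v, hv, hv0, fun h hh => ⟨1, ?_⟩⟩
    rw [Function.iterate_zero, id] at hn
    rw [hn, Subgroup.mem_bot] at hh
    simp [hh]
  | succ n ih =>
    have hle : ⁅H, H⁆ ≤ H := H.commutator_le_self
    obtain ⟨v, hv, hv0, hcv⟩ := ih ⁅H, H⁆ hH.commutator
      (by rwa [Function.iterate_succ_apply] at hn) W hW (fun h hh => hHW h (hle hh))
    choose! χ hχ using hcv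
    have hinj : ∀ (g : G) (w : V), w ≠ 0 → ρ g w ≠ 0 := fun g w hw h => hw <| by
      have : ρ (g⁻¹ * g) w = 0 := by rw [map_mul, Module.End.mul_apply, h, map_zero]
      simpa using this
    obtain ⟨l, hl, -⟩ := exists_dual_apply_eq_one (N := ⊥) (v := v) (by simpa using hv0)
    have hconj : ∀ x ∈ H, ∀ h ∈ ⁅H, H⁆, x⁻¹ * h * x ∈ ⁅H, H⁆ := by
      intro x hx h hh
      have hmem := mul_mem hh (Subgroup.commutator_mem_commutator (hle (inv_mem hh))
        (inv_mem hx))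
      have e : h * ⁅h⁻¹, x⁻¹⁆ = x⁻¹ * h * x := by
        simp [commutatorElement_def, mul_assoc]
      rwa [e] at hmem
    -- `χ (x⁻¹ * h * x)` is an eigenvalue of `h` with eigenvector `x • v`.
    have hχconj : ∀ x ∈ H, ∀ h ∈ ⁅H, H⁆, χ (x⁻¹ * h * x) = χ h := by
      intro x hx h hh
      have key : ∀ z ∈ H, l (ρ (z⁻¹ * h * z) v) = χ (z⁻¹ * h * z) := fun z hz => by
        rw [hχ _ (hconj z hz h hh), map_smul, hl, smul_eq_mul, mul_one]
      have := hH _ (R.conj_mem _ (hρ l v) h) ((ρ h).finite_hasEigenvalue.subset ?_) x hx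
      · rw [key x hx, key 1 H.one_mem] at this
        simpa using this
      · rintro _ ⟨z, hz, rfl⟩
        simp only
        rw [key z hz]
        refine Module.End.hasEigenvalue_of_hasEigenvector (x := ρ z v)
          ⟨Module.End.mem_eigenspace_iff.2 ?_, hinj z v hv0⟩
        rw [← map_smul, ← hχ _ (hconj z hz h hh), ← Module.End.mul_apply, ← Module.End.mul_apply,
          ← map_mul, ← map_mul]
        congr 2
        group
    let U : Submodule ℂ V :=
      { carrier := {u | u ∈ W ∧ ∀ h ∈ ⁅H, H⁆, ρ h u = χ h • u}
        zero_mem' := ⟨W.zero_mem, fun h _ => by simp⟩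
        add_mem' := fun {a b} ha hb => ⟨W.add_mem ha.1 hb.1, fun h hh => by
          rw [map_add, ha.2 h hh, hb.2 h hh, smul_add]⟩
        smul_mem' := fun c a ha => ⟨W.smul_mem c ha.1, fun h hh => by
          rw [map_smul, ha.2 h hh, smul_comm]⟩ }
    have hvU : v ∈ U := ⟨hv, hχ⟩
    have hU : U ≠ ⊥ := fun h => hv0 (by simpa [h] using hvU)
    have hHU : ∀ x ∈ H, ∀ u ∈ U, ρ x u ∈ U := by
      intro x hx u hu
      refine ⟨hHW x hx u hu.1, fun h hh => ?_⟩
      rw [← hχconj x hx h hh, ← map_smul, ← hu.2 _ (hconj x hx h hh), ← Module.End.mul_apply,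
        ← Module.End.mul_apply, ← map_mul, ← map_mul]
      congr 2
      group
    -- For an eigenvalue `c` of `y` on `U`, also `c / χ ⁅x, y⁆` is an eigenvalue of `y`.
    have hone : ∀ x ∈ H, ∀ y ∈ H, χ ⁅x, y⁆ = 1 := by
      intro x hx y hy
      have key : ∀ z ∈ H, l (ρ ⁅z, y⁆ v) = χ ⁅z, y⁆ := fun z hz => by
        rw [hχ _ (Subgroup.commutator_mem_commutator hz hy), map_smul, hl, smul_eq_mul, mul_one]
      obtain ⟨c, w, hwU, hw0, hcw⟩ := exists_eigenvector_mem (ρ y) hU (hHU y hy)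
      have hc0 : c ≠ 0 := fun h => hinj y w hw0 (by rw [hcw, h, zero_smul])
      have hfin : ((fun μ => c / μ) '' {μ | (ρ y).HasEigenvalue μ}).Finite :=
        (ρ y).finite_hasEigenvalue.image _
      have := hH _ (R.commutator_mem (hρ l v) y) (hfin.subset ?_) x hx
      · rw [key x hx] at this
        simpa [hl] using this
      · rintro _ ⟨z, hz, rfl⟩
        simp only
        rw [key z hz]
        have hzw : ρ z w ∈ U := hHU z hz w hwU
        have hyzw : ρ y (ρ z w) ∈ U := hHU y hy _ hzw
        -- `z y = ⁅z, y⁆ y z`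
        have e : χ ⁅z, y⁆ • ρ y (ρ z w) = c • ρ z w := by
          rw [← hyzw.2 _ (Subgroup.commutator_mem_commutator hz hy), ← map_smul, ← hcw]
          simp only [← Module.End.mul_apply, ← map_mul]
          congr 2
          simp [commutatorElement_def, mul_assoc]
        have hχ0 : χ ⁅z, y⁆ ≠ 0 := fun h => by
          rw [h, zero_smul] at e
          exact smul_ne_zero hc0 (hinj z w hw0) e.symm
        refine ⟨c / χ ⁅z, y⁆, ?_, by field_simp⟩
        refine Module.End.hasEigenvalue_of_hasEigenvector (x := ρ z w)
          ⟨Module.End.mem_eigenspace_iff.2 ?_, hinj z w hw0⟩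
        rw [div_eq_inv_mul, mul_smul, ← e, smul_smul, inv_mul_cancel₀ hχ0, one_smul]
    obtain ⟨u, hu, hu0, hcu⟩ := exists_common_eigenvector_of_commute (fun h : H => ρ h) U hU
      (fun h u hu => hHU h h.2 u hu) (fun x y u hu => by
        have hyx : ρ (y * x : G) u ∈ U := hHU _ (mul_mem y.2 x.2) u hu
        have := hyx.2 _ (Subgroup.commutator_mem_commutator x.2 y.2)
        rw [hone x x.2 y y.2, one_smul, ← Module.End.mul_apply, ← map_mul] at this
        simp only [← Module.End.mul_apply, ← map_mul]
        rw [← this]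
        congr 2
        simp [commutatorElement_def, mul_assoc])
    exact ⟨u, hu.1, hu0, fun h hh => hcu ⟨h, hh⟩⟩

end Eigenvectors

/-! ### Fixed points -/

section FixedPoint

variable {V : Type*} [AddCommGroup V] [Module ℂ V] [FiniteDimensional ℂ V]
variable {G : Type*} [Group G] (R : RegularFunctions G) (ρ : G →* Module.End ℂ V)

/-- The Lie–Kolchin theorem in dual form: between stable subspaces `N < M` there is a linear form
that is a semi-invariant on `M`. Such a form has as kernel a maximal proper stable subspace `K` of
`M` containing `N`; by Lie–Kolchin `M ⧸ K` is a line. -/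
theorem exists_semiinvariant_form (hρ : R.IsRational ρ) (hG : R.IsConnected ⊤)
    (hsolv : Group.IsSolvable G) {N M : Submodule ℂ V} (hNM : N < M)
    (hN : ∀ g, ∀ v ∈ N, ρ g v ∈ N) (hM : ∀ g, ∀ v ∈ M, ρ g v ∈ M) :
    ∃ (l : Module.Dual ℂ V) (χ : G → ℂ), (∀ v ∈ N, l v = 0) ∧ (∃ v ∈ M, l v ≠ 0) ∧
      χ ∈ R.functions ∧ (∀ g, χ g * χ g⁻¹ = 1) ∧ ∀ g, ∀ v ∈ M, l (ρ g v) = χ g * l v := by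
  obtain ⟨K, hK⟩ : ∃ K, Maximal (fun K : Submodule ℂ V => N ≤ K ∧ K < M ∧
      ∀ g, ∀ v ∈ K, ρ g v ∈ K) K := by
    obtain ⟨K, -, hK⟩ := exists_maximal_ge_of_wellFoundedGT (fun K : Submodule ℂ V => N ≤ K ∧ K < M ∧
      ∀ g, ∀ v ∈ K, ρ g v ∈ K) N ⟨le_rfl, hNM, hN⟩
    exact ⟨K, hK⟩
  obtain ⟨hNK, hKM, hKs⟩ := hK.prop
  let σ : G →* Module.End ℂ (V ⧸ K) :=
    { toFun := fun g => K.mapQ K (ρ g) (hKs g)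
      map_one' := by ext v; simp
      map_mul' := fun g h => by ext v; simp }
  have hσ : ∀ g v, σ g (K.mkQ v) = K.mkQ (ρ g v) := fun g v => rfl
  have hσR : R.IsRational σ := by
    intro l v
    obtain ⟨v, rfl⟩ := K.mkQ_surjective v
    exact hρ (l ∘ₗ K.mkQ) v
  obtain ⟨n, hn⟩ := hsolv.solvable
  have hiter : ∀ n, (fun K : Subgroup G => ⁅K, K⁆)^[n] ⊤ = derivedSeries G n := by
    intro n
    induction n with
    | zero => rfl
    | succ n ih => rw [Function.iterate_succ_apply', ih, derivedSeries_succ]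
  obtain ⟨w, hw⟩ := SetLike.exists_of_lt hKM
  obtain ⟨q, hqM, hq0, hq⟩ := exists_eigenvector_of_solvable R σ hσR n ⊤ hG
    ((hiter n).trans hn) (M.map K.mkQ)
    (fun h => hw.2 <| by
      have : K.mkQ w ∈ M.map K.mkQ := Submodule.mem_map_of_mem hw.1
      simpa [h] using this)
    (by
      rintro g - _ ⟨v, hv, rfl⟩
      exact ⟨ρ g v, hM g v hv, rfl⟩)
  obtain ⟨v₀, hv₀M, rfl⟩ := hqM
  have hv₀ : v₀ ∉ K := fun h => hq0 (by simpa using h)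
  have hc : ∀ g, ∃ c : ℂ, ρ g v₀ - c • v₀ ∈ K := fun g => by
    obtain ⟨c, hc⟩ := hq g trivial
    refine ⟨c, ?_⟩
    rw [hσ, ← map_smul, ← sub_eq_zero, ← map_sub] at hc
    exact (Submodule.Quotient.mk_eq_zero K).1 hc
  choose χ hχ using hc
  -- Maximality of `K` gives `M = K ⊕ ℂ v₀`, as the right hand side is stable.
  have hMK : M ≤ K ⊔ Submodule.span ℂ {v₀} := by
    by_contra hcon
    have hlt : K ⊔ Submodule.span ℂ {v₀} < M :=
      lt_of_le_of_ne (sup_le hKM.le (by simpa using hv₀M)) fun h => hcon h.ge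
    refine hv₀ (hK.le_of_ge ⟨hNK.trans le_sup_left, hlt, ?_⟩ le_sup_left
      (Submodule.mem_sup_right (Submodule.mem_span_singleton_self v₀)))
    intro g v hv
    obtain ⟨k, hk, c, rfl⟩ : ∃ k ∈ K, ∃ c : ℂ, k + c • v₀ = v := by
      obtain ⟨k, hk, y, hy, rfl⟩ := Submodule.mem_sup.1 hv
      obtain ⟨c, rfl⟩ := Submodule.mem_span_singleton.1 hy
      exact ⟨k, hk, c, rfl⟩
    have e : ρ g (k + c • v₀) = (ρ g k + c • (ρ g v₀ - χ g • v₀)) + (c * χ g) • v₀ := by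
      rw [map_add, map_smul, smul_sub, smul_smul]
      abel
    rw [e]
    exact Submodule.add_mem_sup (K.add_mem (hKs g k hk) (K.smul_mem c (hχ g)))
      (Submodule.smul_mem _ _ (Submodule.mem_span_singleton_self v₀))
  obtain ⟨l, hl1, hlK⟩ := exists_dual_apply_eq_one hv₀
  have hlχ : ∀ g, l (ρ g v₀) = χ g := fun g => by
    have := hlK _ (hχ g)
    rwa [map_sub, map_smul, hl1, smul_eq_mul, mul_one, sub_eq_zero] at this
  have hsemi : ∀ g, ∀ v ∈ M, l (ρ g v) = χ g * l v := by
    intro g v hv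
    obtain ⟨k, hk, y, hy, rfl⟩ := Submodule.mem_sup.1 (hMK hv)
    obtain ⟨c, rfl⟩ := Submodule.mem_span_singleton.1 hy
    simp [hlK k hk, hlK _ (hKs g k hk), hlχ, hl1, mul_comm]
  refine ⟨l, χ, fun v hv => hlK v (hNK hv), ⟨v₀, hv₀M, by simp [hl1]⟩, ?_, fun g => ?_, hsemi⟩
  · simpa [hlχ] using hρ l v₀
  · rw [← hlχ g⁻¹, ← hsemi g _ (hM _ _ hv₀M), ← Module.End.mul_apply, ← map_mul]
    simp [hl1]

/-- A form of the Borel fixed point theorem. The points of a compact set `Y` are mapped by `φ` to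
nonzero vectors of `V ⧸ N`, and the set of lines spanned by these is stable under `G`; then one of
the lines is fixed by `G`. Take a semi-invariant form `l` on `V ⧸ N`. If `l` vanishes somewhere on
`φ(Y)`, pass to its kernel. If not, the ratio of any other form to `l` is regular along an orbit, and
bounded as `Y` is compact, hence constant: every point is fixed. -/
theorem exists_fixed_line {X : Type*} [TopologicalSpace X] (φ : X → V)
    (hφ : ∀ l : Module.Dual ℂ V, Continuous fun y => l (φ y))
    (hρ : R.IsRational ρ) (hG : R.IsConnected ⊤) (hsolv : Group.IsSolvable G)
    (hbdd : ∀ f ∈ R.functions, (∃ C : ℝ, ∀ g, ‖f g‖ ≤ C) → ∀ g, f g = f 1)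
    {N : Submodule ℂ V} (hN : ∀ g, ∀ v ∈ N, ρ g v ∈ N) (M : Submodule ℂ V) (hNM : N ≤ M)
    (hM : ∀ g, ∀ v ∈ M, ρ g v ∈ M) (Y : Set X) (hY : IsCompact Y) (hne : Y.Nonempty)
    (hYM : ∀ y ∈ Y, φ y ∈ M) (hYN : ∀ y ∈ Y, φ y ∉ N)
    (hYG : ∀ y ∈ Y, ∀ g, ∃ y' ∈ Y, ∃ c : ℂ, ρ g (φ y) - c • φ y' ∈ N) :
    ∃ y ∈ Y, ∀ g, ∃ c : ℂ, ρ g (φ y) - c • φ y ∈ N := by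
  induction h : Module.finrank ℂ M using Nat.strong_induction_on generalizing M Y with
  | _ n ih =>
    subst h
    obtain ⟨y₀, hy₀⟩ := hne
    have hlt : N < M := lt_of_le_of_ne hNM fun h => hYN y₀ hy₀ (h ▸ hYM y₀ hy₀)
    obtain ⟨l, χ, hlN, ⟨v₁, hv₁, hlv₁⟩, hχR, hχ, hl⟩ :=
      exists_semiinvariant_form R ρ hρ hG hsolv hlt hN hM
    by_cases hzero : ∃ y ∈ Y, l (φ y) = 0
    · obtain ⟨y₁, hy₁, hly₁⟩ := hzero
      let M' := M ⊓ LinearMap.ker l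
      have hM'lt : M' < M :=
        lt_of_le_of_ne inf_le_left fun h => hlv₁ ((h ▸ hv₁ : v₁ ∈ M').2)
      have hclosed : IsClosed {y : X | l (φ y) = 0} := isClosed_eq (hφ l) continuous_const
      obtain ⟨y, hy, hfix⟩ := ih _ (Submodule.finrank_lt_finrank_of_lt hM'lt) M'
        (fun v hv => ⟨hNM hv, hlN v hv⟩)
        (fun g v hv => ⟨hM g v hv.1, by
          have : l v = 0 := hv.2
          simp [hl g v hv.1, this]⟩)
        (Y ∩ {y : X | l (φ y) = 0}) (hY.inter_right hclosed) ⟨y₁, hy₁, hly₁⟩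
        (fun y hy => ⟨hYM y hy.1, hy.2⟩) (fun y hy => hYN y hy.1)
        (by
          rintro y ⟨hy, hly⟩ g
          obtain ⟨y', hy', c, hc⟩ := hYG y hy g
          have hly' : l (φ y) = 0 := hly
          -- If `c = 0`, then `ρ g (φ y) ∈ N`, and every point of the smaller set will do.
          by_cases hc0 : c = 0
          · exact ⟨y, ⟨hy, hly⟩, 0, by simpa [hc0] using hc⟩
          · refine ⟨y', ⟨hy', ?_⟩, c, hc⟩
            have := hlN _ hc
            rw [map_sub, hl g _ (hYM y hy), hly', map_smul] at this
            simpa [hc0] using this) rfl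
      exact ⟨y, hy.1, hfix⟩
    · push Not at hzero
      refine ⟨y₀, hy₀, fun g => ⟨χ g, ?_⟩⟩
      by_contra hcon
      obtain ⟨θ, hθ, hθN⟩ := exists_dual_apply_eq_one hcon
      have hχ0 : ∀ g, χ g ≠ 0 := fun g h => by simpa [h] using hχ g
      have hcont : ContinuousOn (fun y => θ (φ y) / l (φ y)) Y :=
        (hφ θ).continuousOn.div (hφ l).continuousOn hzero
      obtain ⟨C, hC⟩ := hY.exists_bound_of_continuousOn hcont
      -- This is `θ / l` along the orbit of `φ y₀`, since `l (ρ g (φ y₀)) = χ g * l (φ y₀)`.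
      have hreg : (fun g => (χ g⁻¹ * (l (φ y₀))⁻¹) * θ (ρ g (φ y₀))) ∈ R.functions := by
        have h1 := R.functions.smul_mem (R.functions.mul_mem (R.comp_inv_mem χ hχR)
          (hρ θ (φ y₀))) (l (φ y₀))⁻¹
        convert h1 using 1
        ext g
        simp
        ring
      have hconst := hbdd _ hreg ⟨C, fun g => ?_⟩ g
      · simp only [map_one, inv_one, Module.End.one_apply] at hconst
        have h1 : χ 1 = 1 := by
          have := hl 1 _ (hYM y₀ hy₀)
          simpa [hzero y₀ hy₀] using this
        have h2 : θ (ρ g (φ y₀)) = χ g * θ (φ y₀) := by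
          have hl0 := hzero y₀ hy₀
          have h3 := hχ g
          rw [h1] at hconst
          field_simp at hconst
          linear_combination (χ g) * hconst - θ (ρ g (φ y₀)) * h3
        rw [map_sub, map_smul, h2, smul_eq_mul, sub_self] at hθ
        exact zero_ne_one hθ
      · obtain ⟨y', hy', c, hc⟩ := hYG y₀ hy₀ g
        have hθ' := hθN _ hc
        have hl' := hlN _ hc
        rw [map_sub, map_smul, sub_eq_zero, smul_eq_mul] at hθ' hl'
        rw [hl g _ (hYM y₀ hy₀)] at hl'
        have hl0 := hzero y₀ hy₀
        have hly' := hzero y' hy'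
        have e : χ g⁻¹ * (l (φ y₀))⁻¹ * θ (ρ g (φ y₀)) = θ (φ y') / l (φ y') := by
          have h3 := hχ g
          rw [hθ']
          field_simp
          apply mul_left_cancel₀ (hχ0 g)
          linear_combination (θ (φ y')) * (c * l (φ y') * h3) - θ (φ y') * hl'
        rw [e]
        exact hC y' hy'

end FixedPoint

/-! ### Regular functions on an affine variety over the complex numbers -/

/-- If `a - z` is invertible for uncountably many scalars `z`, in an algebra of countable dimension,
then `a` is algebraic: otherwise the inverses would be linearly independent. -/
theorem exists_aeval_eq_zero_of_uncountable {A : Type} [CommRing A] [Algebra ℂ A]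
    (hA : Module.rank ℂ A ≤ Cardinal.aleph0) (a : A) (S : Set ℂ) (hS : ¬ S.Countable)
    (h : ∀ z ∈ S, IsUnit (a - algebraMap ℂ A z)) :
    ∃ Q : Polynomial ℂ, Q ≠ 0 ∧ Polynomial.aeval a Q = 0 := by
  classical
  have hu : ∀ z : S, ∃ u, (a - algebraMap ℂ A z) * u = 1 := fun z => (h z z.2).exists_right_inv
  choose u hu using hu
  have hdep : ¬ LinearIndependent ℂ u := fun hli => hS <| by
    rw [← Set.countable_coe_iff, ← Cardinal.mk_le_aleph0_iff]
    exact hli.cardinal_le_rank.trans hA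
  rw [linearIndependent_iff'] at hdep
  push Not at hdep
  obtain ⟨s, c, hsum, z₀, hz₀, hc⟩ := hdep
  refine ⟨∑ z ∈ s, Polynomial.C (c z) * ∏ w ∈ s.erase z, (Polynomial.X - Polynomial.C (w : ℂ)),
    fun h0 => ?_, ?_⟩
  · have := congrArg (Polynomial.eval (z₀ : ℂ)) h0
    rw [Polynomial.eval_finsetSum, Finset.sum_eq_single z₀] at this
    · simp only [Polynomial.eval_mul, Polynomial.eval_C, Polynomial.eval_prod, Polynomial.eval_sub,
        Polynomial.eval_X, Polynomial.eval_zero, mul_eq_zero, hc, false_or] at this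
      obtain ⟨w, hw, hw0⟩ := Finset.prod_eq_zero_iff.1 this
      exact (Finset.ne_of_mem_erase hw) (Subtype.ext (sub_eq_zero.1 hw0)).symm
    · intro z _ hz
      rw [Polynomial.eval_mul, Polynomial.eval_prod,
        Finset.prod_eq_zero (Finset.mem_erase.2 ⟨hz.symm, hz₀⟩) (by simp), mul_zero]
    · exact fun h => absurd hz₀ h
  · have e : ∀ z ∈ s, (∏ w ∈ s, (a - algebraMap ℂ A w)) * (c z • u z) =
        Polynomial.aeval a (Polynomial.C (c z) *
          ∏ w ∈ s.erase z, (Polynomial.X - Polynomial.C (w : ℂ))) := by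
      intro z hz
      rw [← Finset.mul_prod_erase s _ hz]
      simp only [map_mul, map_prod, map_sub, Polynomial.aeval_X, Polynomial.aeval_C]
      rw [Algebra.smul_def]
      linear_combination (algebraMap ℂ A (c z) * ∏ w ∈ s.erase z, (a - algebraMap ℂ A w)) * hu z
    rw [map_sum, ← Finset.sum_congr rfl e, ← Finset.mul_sum, hsum, mul_zero]

/-- A polynomial that is bounded on a complex affine variety takes finitely many values there: for
all large `z`, the polynomial minus `z` is invertible in the coordinate ring by the Nullstellensatz,
and the coordinate ring has countable dimension. -/
theorem finite_image_of_bounded {σ : Type} [Finite σ] (I : Ideal (MvPolynomial σ ℂ))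
    (P : MvPolynomial σ ℂ) (C : ℝ) (hC : ∀ x ∈ MvPolynomial.zeroLocus ℂ I, ‖MvPolynomial.eval x P‖ ≤ C) :
    ((fun x => MvPolynomial.eval x P) '' MvPolynomial.zeroLocus ℂ I).Finite := by
  let q := Ideal.Quotient.mkₐ ℂ I
  have hrank : Module.rank ℂ (MvPolynomial σ ℂ ⧸ I) ≤ Cardinal.aleph0 := by
    refine (LinearMap.rank_le_of_surjective q.toLinearMap (Ideal.Quotient.mkₐ_surjective ℂ I)).trans ?_
    rw [MvPolynomial.rank_eq]
    exact Cardinal.mk_le_aleph0_iff.2 inferInstance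
  have hS : ¬ {z : ℂ | C < ‖z‖}.Countable := by
    intro hcount
    have hpre : ((fun x : ℝ => (x : ℂ)) ⁻¹' {z : ℂ | C < ‖z‖}).Countable :=
      hcount.preimage Complex.ofReal_injective
    have hIoi : (Set.Ioi C).Countable := hpre.mono fun x (hx : C < x) => by
      have h : C < ‖(x : ℂ)‖ := by
        rw [Complex.norm_real]
        exact lt_of_lt_of_le hx (le_abs_self x)
      exact h
    rw [← Set.countable_coe_iff, ← Cardinal.mk_le_aleph0_iff, Cardinal.mk_Ioi_real] at hIoi
    exact not_lt.2 hIoi Cardinal.aleph0_lt_continuum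
  obtain ⟨Q, hQ0, hQ⟩ := exists_aeval_eq_zero_of_uncountable hrank (q P) _ hS (by
    intro z hz
    have htop : I ⊔ Ideal.span {P - MvPolynomial.C z} = ⊤ := by
      by_contra hne
      obtain ⟨m, hm, hle⟩ := Ideal.exists_le_maximal _ hne
      obtain ⟨x, rfl⟩ := MvPolynomial.isMaximal_iff_eq_vanishingIdeal_singleton.1 hm
      have hxI : x ∈ MvPolynomial.zeroLocus ℂ I := fun p hp =>
        (MvPolynomial.mem_vanishingIdeal_singleton_iff x p).1 (hle (Ideal.mem_sup_left hp))
      have hxP := (MvPolynomial.mem_vanishingIdeal_singleton_iff x _).1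
        (hle (Ideal.mem_sup_right (Ideal.mem_span_singleton_self (P - MvPolynomial.C z))))
      have : MvPolynomial.eval x P = z := by
        simpa [sub_eq_zero, MvPolynomial.aeval_eq_eval] using hxP
      exact absurd (this ▸ hC x hxI) (not_le.2 hz)
    obtain ⟨i, hi, y, hy, hiy⟩ := Submodule.mem_sup.1 ((Ideal.eq_top_iff_one _).1 htop)
    obtain ⟨b, rfl⟩ := Ideal.mem_span_singleton.1 hy
    refine IsUnit.of_mul_eq_one (q b) ?_
    have hqi : q i = 0 := Ideal.Quotient.eq_zero_iff_mem.2 hi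
    have := congrArg q hiy
    rw [map_add, hqi, zero_add, map_mul, map_sub, map_one] at this
    simpa [← MvPolynomial.algebraMap_eq] using this)
  refine (Q.roots.toFinset.finite_toSet).subset ?_
  rintro _ ⟨x, hx, rfl⟩
  have hmem : Polynomial.aeval P Q ∈ I := by
    rw [← Ideal.Quotient.eq_zero_iff_mem]
    have : q (Polynomial.aeval P Q) = 0 := by rw [← Polynomial.aeval_algHom_apply, hQ]
    exact this
  have h0 := hx _ hmem
  rw [← Polynomial.aeval_algHom_apply] at h0
  simpa [hQ0, MvPolynomial.aeval_eq_eval, Polynomial.aeval_def] using h0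

/-! ### Regular functions on a closed subgroup of `GL(A) × GL(B) × GL(C)` -/

section Regular

variable {m : ℕ} (B : Subgroup (GL3 m))

/-- The matrix entries of `b` and of `b⁻¹`. -/
def coordinates (b : B) : (Fin 3 × Fin m × Fin m) ⊕ (Fin 3 × Fin m × Fin m) → ℂ :=
  Sum.elim (entries (b : GL3 m)) (entries (b⁻¹ : GL3 m))

/-- The algebra of functions on `B` generated by the matrix entries of `b` and of `b⁻¹`. -/
def regularSubalgebra : Subalgebra ℂ (B → ℂ) :=
  Algebra.adjoin ℂ (Set.range fun v b => coordinates B b v)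

variable {B}

theorem entries_mem (v) : (fun b : B => entries (b : GL3 m) v) ∈ regularSubalgebra B :=
  Algebra.subset_adjoin ⟨Sum.inl v, rfl⟩

theorem entries_inv_mem (v) : (fun b : B => entries (b⁻¹ : GL3 m) v) ∈ regularSubalgebra B :=
  Algebra.subset_adjoin ⟨Sum.inr v, rfl⟩

theorem entries_mul (g h : GL3 m) (p : Fin 3) (i j : Fin m) :
    entries (g * h) (p, i, j) = ∑ k, entries g (p, i, k) * entries h (p, k, j) := by
  simp [entries, Matrix.mul_apply]

theorem entries_mul_mem {φ ψ : B → GL3 m}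
    (hφ : ∀ v, (fun b => entries (φ b) v) ∈ regularSubalgebra B)
    (hψ : ∀ v, (fun b => entries (ψ b) v) ∈ regularSubalgebra B) (v) :
    (fun b => entries (φ b * ψ b) v) ∈ regularSubalgebra B := by
  obtain ⟨p, i, j⟩ := v
  simp only [entries_mul]
  have := Subalgebra.sum_mem (regularSubalgebra B) (t := Finset.univ) (f := fun k =>
    (fun b => entries (φ b) (p, i, k)) * fun b => entries (ψ b) (p, k, j))
    fun k _ => Subalgebra.mul_mem _ (hφ _) (hψ _)
  convert this using 1
  ext b
  simp

theorem const_mem (c : ℂ) : (fun _ : B => c) ∈ regularSubalgebra B :=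
  Subalgebra.algebraMap_mem (regularSubalgebra B) c

theorem comp_mem {f : B → ℂ} (hf : f ∈ regularSubalgebra B) (φ : B → B)
    (hφ : ∀ v, (fun b => entries (φ b : GL3 m) v) ∈ regularSubalgebra B)
    (hφ' : ∀ v, (fun b => entries ((φ b : GL3 m)⁻¹) v) ∈ regularSubalgebra B) :
    (fun b => f (φ b)) ∈ regularSubalgebra B := by
  unfold regularSubalgebra at hf
  induction hf using Algebra.adjoin_induction with
  | mem f hf =>
    obtain ⟨v, rfl⟩ := hf
    cases v with
    | inl v => exact hφ v
    | inr v => exact hφ' v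
  | algebraMap c => exact const_mem c
  | add f g _ _ ihf ihg => exact Subalgebra.add_mem _ ihf ihg
  | mul f g _ _ ihf ihg => exact Subalgebra.mul_mem _ ihf ihg

variable (B) in
/-- The regular functions on a subgroup of `GL(A) × GL(B) × GL(C)`. -/
def regularFunctions : RegularFunctions B where
  functions := regularSubalgebra B
  mul_left_mem f hf a := by
    refine comp_mem hf (fun x => a * x) (entries_mul_mem (fun _ => const_mem _) entries_mem) ?_
    simp only [Subgroup.coe_mul, mul_inv_rev]
    exact entries_mul_mem entries_inv_mem fun _ => const_mem _
  comp_inv_mem f hf := by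
    refine comp_mem hf (fun x => x⁻¹) entries_inv_mem ?_
    simp only [Subgroup.coe_inv, inv_inv]
    exact entries_mem
  conj_mem f hf y := by
    refine comp_mem hf (fun x => x⁻¹ * y * x)
      (entries_mul_mem (entries_mul_mem entries_inv_mem fun _ => const_mem _) entries_mem) ?_
    simp only [Subgroup.coe_mul, mul_inv_rev, Subgroup.coe_inv, inv_inv]
    exact entries_mul_mem entries_inv_mem (entries_mul_mem (fun _ => const_mem _) entries_mem)

/-- The polynomial `det(g₁) det(g₂) det(g₃)` in the matrix entries of `g`. -/
noncomputable def detPoly (m : ℕ) : MvPolynomial (Fin 3 × Fin m × Fin m) ℂ :=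
  ∏ p, (Matrix.of fun i j => MvPolynomial.X (p, i, j)).det

theorem map_entries (g : GL3 m) (p : Fin 3) :
    (MvPolynomial.eval (entries g)).mapMatrix (Matrix.of fun i j => MvPolynomial.X (p, i, j)) =
      (g p : Matrix (Fin m) (Fin m) ℂ) := by
  ext i j
  simp [entries]

theorem eval_detPoly (g : GL3 m) :
    MvPolynomial.eval (entries g) (detPoly m) = ∏ p, (g p : Matrix (Fin m) (Fin m) ℂ).det := by
  simp only [detPoly, map_prod, RingHom.map_det, map_entries]

theorem eval_detPoly_ne_zero (g : GL3 m) : MvPolynomial.eval (entries g) (detPoly m) ≠ 0 := by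
  rw [eval_detPoly, Finset.prod_ne_zero_iff]
  exact fun p _ => ((Matrix.isUnit_iff_isUnit_det _).1 (g p).isUnit).ne_zero

/-- Up to a power of the determinant, a regular function is a polynomial in the matrix entries. -/
theorem exists_eval_entries {f : B → ℂ} (hf : f ∈ regularSubalgebra B) :
    ∃ (P : MvPolynomial (Fin 3 × Fin m × Fin m) ℂ) (k : ℕ), ∀ b : B,
      f b * MvPolynomial.eval (entries (b : GL3 m)) (detPoly m) ^ k =
        MvPolynomial.eval (entries (b : GL3 m)) P := by
  unfold regularSubalgebra at hf
  induction hf using Algebra.adjoin_induction with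
  | mem f hf =>
    obtain ⟨v, rfl⟩ := hf
    cases v with
    | inl v => exact ⟨MvPolynomial.X v, 0, fun b => by simp [coordinates]⟩
    | inr v =>
      obtain ⟨p, i, j⟩ := v
      refine ⟨(Matrix.of fun i j => MvPolynomial.X (p, i, j)).adjugate i j *
        ∏ p' ∈ Finset.univ.erase p, (Matrix.of fun i j => MvPolynomial.X (p', i, j)).det, 1,
        fun b => ?_⟩
      have hdet : ((b : GL3 m) p : Matrix (Fin m) (Fin m) ℂ).det ≠ 0 :=
        ((Matrix.isUnit_iff_isUnit_det _).1 ((b : GL3 m) p).isUnit).ne_zero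
      have hadj : MvPolynomial.eval (entries (b : GL3 m))
          ((Matrix.of fun i j => MvPolynomial.X (p, i, j)).adjugate i j) =
          ((b : GL3 m) p : Matrix (Fin m) (Fin m) ℂ).adjugate i j := by
        rw [← map_entries, ← RingHom.map_adjugate]
        rfl
      rw [map_mul, hadj, map_prod, pow_one, eval_detPoly,
        ← Finset.mul_prod_erase _ _ (Finset.mem_univ p)]
      simp only [RingHom.map_det, map_entries]
      simp only [coordinates, Sum.elim_inr, entries, Pi.inv_apply, Matrix.coe_units_inv,
        Matrix.inv_def, Ring.inverse_eq_inv', Matrix.smul_apply, smul_eq_mul]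
      field_simp
  | algebraMap c => exact ⟨MvPolynomial.C c, 0, fun b => by simp⟩
  | add f g _ _ ihf ihg =>
    obtain ⟨P, k, hP⟩ := ihf
    obtain ⟨Q, l, hQ⟩ := ihg
    refine ⟨P * detPoly m ^ l + Q * detPoly m ^ k, k + l, fun b => ?_⟩
    simp only [map_add, map_mul, map_pow, ← hP, ← hQ, Pi.add_apply]
    ring
  | mul f g _ _ ihf ihg =>
    obtain ⟨P, k, hP⟩ := ihf
    obtain ⟨Q, l, hQ⟩ := ihg
    refine ⟨P * Q, k + l, fun b => ?_⟩
    simp only [map_mul, ← hP, ← hQ, Pi.mul_apply]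
    ring

theorem exists_zariskiClosed_eq_zero {f : B → ℂ} (hf : f ∈ regularSubalgebra B) :
    ∃ Z : Set (GL3 m), IsZariskiClosed Z ∧ ∀ b : B, (b : GL3 m) ∈ Z ↔ f b = 0 := by
  obtain ⟨P, k, hP⟩ := exists_eval_entries hf
  refine ⟨{g | ∀ f ∈ ({P} : Set _), MvPolynomial.eval (entries g) f = 0}, ⟨{P}, rfl⟩, fun b => ?_⟩
  simp [← hP, eval_detPoly_ne_zero]

theorem regularFunctions_isConnected (hB : IsZariskiConnected (B : Set (GL3 m))) :
    (regularFunctions B).IsConnected ⊤ := by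
  classical
  intro f hf hfin b _
  have hcoe : (((⊤ : Subgroup B) : Set B)) = Set.univ := rfl
  rw [hcoe, Set.image_univ] at hfin
  obtain ⟨Z, hZ, hZf⟩ := exists_zariskiClosed_eq_zero (Subalgebra.sub_mem _ hf (const_mem (f 1)))
  obtain ⟨Z', hZ', hZf'⟩ := exists_zariskiClosed_eq_zero (B := B)
    (f := ∏ z ∈ hfin.toFinset.erase (f 1), (f - fun _ => z))
    (Subalgebra.prod_mem _ fun z _ => Subalgebra.sub_mem _ hf (const_mem z))
  have hZ'iff : ∀ b : B, (b : GL3 m) ∈ Z' ↔ f b ≠ f 1 := fun b => by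
    rw [hZf', Finset.prod_apply, Finset.prod_eq_zero_iff]
    constructor
    · rintro ⟨z, hz, h0⟩
      rw [sub_eq_zero.1 h0]
      exact Finset.ne_of_mem_erase hz
    · exact fun h => ⟨f b, Finset.mem_erase.2 ⟨h, by simp⟩, by simp⟩
  have hZiff : ∀ b : B, (b : GL3 m) ∈ Z ↔ f b = f 1 := fun b => by
    rw [hZf, Pi.sub_apply, sub_eq_zero]
  have hcover : (B : Set (GL3 m)) ⊆ Z ∪ Z' := fun g hg => by
    by_cases hg1 : f ⟨g, hg⟩ = f 1
    · exact Or.inl ((hZiff ⟨g, hg⟩).2 hg1)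
    · exact Or.inr ((hZ'iff ⟨g, hg⟩).2 hg1)
  have hdisj : (B : Set (GL3 m)) ∩ (Z ∩ Z') = ∅ := by
    ext g
    simp only [Set.mem_inter_iff, Set.mem_empty_iff_false, iff_false]
    rintro ⟨hg, h1, h2⟩
    exact (hZ'iff ⟨g, hg⟩).1 h2 ((hZiff ⟨g, hg⟩).1 h1)
  rcases hB Z Z' hZ hZ' hcover hdisj with h | h
  · exact (hZiff b).1 (h b.2)
  · exact absurd rfl ((hZ'iff 1).1 (h (1 : B).2))

/-- On a closed subgroup, a bounded regular function takes finitely many values. -/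
theorem finite_range_of_bounded (hB : IsZariskiClosed (B : Set (GL3 m))) {f : B → ℂ}
    (hf : f ∈ regularSubalgebra B) (hbdd : ∃ C : ℝ, ∀ b, ‖f b‖ ≤ C) : (Set.range f).Finite := by
  classical
  obtain ⟨C, hC⟩ := hbdd
  obtain ⟨S, hS⟩ := hB
  rw [regularSubalgebra, Algebra.adjoin_range_eq_range_aeval] at hf
  obtain ⟨P, rfl⟩ := hf
  have hP : ∀ (P : MvPolynomial ((Fin 3 × Fin m × Fin m) ⊕ (Fin 3 × Fin m × Fin m)) ℂ) (b : B),
      MvPolynomial.aeval (fun v b => coordinates B b v) P b =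
      MvPolynomial.eval (coordinates B b) P := by
    intro P b
    induction P using MvPolynomial.induction_on with
    | C a => simp
    | add p q hp hq => simp only [map_add, Pi.add_apply, hp, hq]
    | mul_X p v hp => simp only [map_mul, Pi.mul_apply, hp, MvPolynomial.aeval_X, MvPolynomial.eval_X]
  let V := Fin 3 × Fin m × Fin m
  -- The coordinates of the elements of `B` form an affine variety: besides the equations of `B`,
  -- those of the relation `g * g⁻¹ = 1`.
  let rel : V → MvPolynomial (V ⊕ V) ℂ := fun v =>
    ∑ k, MvPolynomial.X (Sum.inl (v.1, v.2.1, k)) * MvPolynomial.X (Sum.inr (v.1, k, v.2.2)) -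
      MvPolynomial.C ((1 : Matrix (Fin m) (Fin m) ℂ) v.2.1 v.2.2)
  let I : Ideal (MvPolynomial (V ⊕ V) ℂ) :=
    Ideal.span (MvPolynomial.rename Sum.inl '' S ∪ Set.range rel)
  have hI : ∀ x, x ∈ MvPolynomial.zeroLocus ℂ I ↔ ∃ b : B, x = coordinates B b := by
    intro x
    rw [MvPolynomial.zeroLocus_span]
    constructor
    · intro hx
      let M : Fin 3 → Matrix (Fin m) (Fin m) ℂ := fun p => Matrix.of fun i j => x (Sum.inl (p, i, j))
      let N : Fin 3 → Matrix (Fin m) (Fin m) ℂ := fun p => Matrix.of fun i j => x (Sum.inr (p, i, j))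
      have hMN : ∀ p, M p * N p = 1 := fun p => by
        ext i j
        have := hx _ (Or.inr ⟨(p, i, j), rfl⟩)
        simp only [rel, map_sub, map_sum, map_mul, MvPolynomial.aeval_X, MvPolynomial.aeval_C] at this
        rw [Matrix.mul_apply, ← sub_eq_zero]
        exact this
      let g : GL3 m := fun p => ⟨M p, N p, hMN p, mul_eq_one_comm.1 (hMN p)⟩
      have hg : g ∈ (B : Set (GL3 m)) := by
        rw [hS]
        intro f hf
        have := hx _ (Or.inl ⟨f, hf, rfl⟩)
        rw [MvPolynomial.aeval_rename] at this
        exact this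
      refine ⟨⟨g, hg⟩, ?_⟩
      ext v
      rcases v with ⟨p, i, j⟩ | ⟨p, i, j⟩ <;> rfl
    · rintro ⟨b, rfl⟩ p (⟨f, hf, rfl⟩ | ⟨⟨p, i, j⟩, rfl⟩)
      · rw [MvPolynomial.aeval_rename]
        have : (b : GL3 m) ∈ (B : Set (GL3 m)) := b.2
        rw [hS] at this
        exact this f hf
      · have h1 := entries_mul (b : GL3 m) (b⁻¹ : GL3 m) p i j
        rw [mul_inv_cancel] at h1
        simp only [rel, map_sub, map_sum, map_mul, MvPolynomial.aeval_X, coordinates,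
          Sum.elim_inl, Sum.elim_inr, ← h1]
        simp [entries]
  refine (finite_image_of_bounded I P C ?_).subset ?_
  · intro x hx
    obtain ⟨b, rfl⟩ := (hI x).1 hx
    rw [← hP]
    exact hC b
  · rintro _ ⟨b, rfl⟩
    exact ⟨coordinates B b, (hI _).2 ⟨b, rfl⟩, (hP P b).symm⟩

/-- The representation of a subgroup on `A^{⊗ s} ⊗ B^{⊗ t} ⊗ C^{⊗ u}`. -/
def actHom (B : Subgroup (GL3 m)) (d : Fin 3 → ℕ) : B →* Module.End ℂ (Tens m d) where
  toFun b := act d b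
  map_one' := LinearMap.ext (act_one d)
  map_mul' g h := LinearMap.ext (act_mul d (g : GL3 m) h)

theorem actHom_isRational (B : Subgroup (GL3 m)) (d : Fin 3 → ℕ) :
    (regularFunctions B).IsRational (actHom B d) := by
  intro l X
  classical
  have h : (fun b : B => l (actHom B d b X)) =
      ∑ i, ∑ j, (fun _ : B => l (Pi.single i 1) * X j) *
        ∏ p, ∏ q, fun b : B => entries (b : GL3 m) (p, i p q, j p q) := by
    ext b
    have hX : actHom B d b X = ∑ i, (actHom B d b X i) • (Pi.single i 1 : Tens m d) := by
      ext i
      simp [Finset.sum_apply, Pi.single_apply]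
    rw [hX, map_sum, Finset.sum_apply]
    refine Finset.sum_congr rfl fun i _ => ?_
    have : actHom B d b X i = ∑ j, actMatrix d (b : GL3 m) i j * X j := rfl
    rw [map_smul, this, Finset.sum_apply, smul_eq_mul, Finset.sum_mul]
    refine Finset.sum_congr rfl fun j _ => ?_
    simp only [actMatrix, Matrix.of_apply, Pi.mul_apply, Finset.prod_apply, entries]
    ring
  rw [h]
  exact Subalgebra.sum_mem _ fun i _ => Subalgebra.sum_mem _ fun j _ =>
    Subalgebra.mul_mem _ (const_mem _) (Subalgebra.prod_mem _ fun p _ =>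
      Subalgebra.prod_mem _ fun q _ => entries_mem _)

end Regular

/-! ### Orthonormal frames and flags -/

section Frames

variable {ι : Type} [Fintype ι] {r : ℕ}

/-- Orthonormality of `r` vectors for the standard Hermitian product. -/
def IsOrthonormalFrame (e : Fin r → ι → ℂ) : Prop :=
  ∀ i j, star (e i) ⬝ᵥ e j = if i = j then 1 else 0

/-- The span of the first `j` vectors of a frame. -/
def frameSpan (e : Fin r → ι → ℂ) (j : ℕ) : Submodule ℂ (ι → ℂ) :=
  Submodule.span ℂ (e '' {i | (i : ℕ) < j})

omit [Fintype ι] in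
theorem mem_frameSpan (e : Fin r → ι → ℂ) {j : ℕ} {i : Fin r} (h : (i : ℕ) < j) :
    e i ∈ frameSpan e j :=
  Submodule.subset_span ⟨i, h, rfl⟩

omit [Fintype ι] in
theorem frameSpan_le {e : Fin r → ι → ℂ} {j : ℕ} {N : Submodule ℂ (ι → ℂ)} :
    frameSpan e j ≤ N ↔ ∀ i : Fin r, (i : ℕ) < j → e i ∈ N := by
  rw [frameSpan, Submodule.span_le]
  constructor
  · exact fun h i hi => h ⟨i, hi, rfl⟩
  · rintro h _ ⟨i, hi, rfl⟩
    exact h i hi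

omit [Fintype ι] in
theorem frameSpan_mono (e : Fin r → ι → ℂ) {j k : ℕ} (h : j ≤ k) : frameSpan e j ≤ frameSpan e k :=
  frameSpan_le.2 fun _ hi => mem_frameSpan e (hi.trans_le h)

omit [Fintype ι] in
theorem frameSpan_succ (e : Fin r → ι → ℂ) (i : Fin r) :
    frameSpan e (i + 1) = frameSpan e i ⊔ Submodule.span ℂ {e i} := by
  refine le_antisymm (frameSpan_le.2 fun k hk => ?_) (sup_le (frameSpan_mono e (Nat.le_succ _)) ?_)
  · rcases Nat.lt_succ_iff_lt_or_eq.1 hk with h | h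
    · exact Submodule.mem_sup_left (mem_frameSpan e h)
    · rw [Fin.ext h]
      exact Submodule.mem_sup_right (Submodule.mem_span_singleton_self _)
  · rw [Submodule.span_singleton_le_iff_mem]
    exact mem_frameSpan e (Nat.lt_succ_self _)

omit [Fintype ι] in
theorem frameSpan_eq_span_range (e : Fin r → ι → ℂ) {j : ℕ} (hj : j ≤ r) :
    frameSpan e j = Submodule.span ℂ (Set.range fun i : Fin j => e (Fin.castLE hj i)) := by
  rw [frameSpan]
  congr 1
  ext v
  constructor
  · rintro ⟨i, hi, rfl⟩
    exact ⟨⟨i, hi⟩, rfl⟩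
  · rintro ⟨i, rfl⟩
    exact ⟨Fin.castLE hj i, i.2, rfl⟩

theorem IsOrthonormalFrame.linearIndependent {e : Fin r → ι → ℂ} (he : IsOrthonormalFrame e) :
    LinearIndependent ℂ e := by
  rw [Fintype.linearIndependent_iff]
  intro c hc i
  have := congrArg (fun v => star (e i) ⬝ᵥ v) hc
  simpa [dotProduct_sum, he i] using this

omit [Fintype ι] in
theorem finrank_frameSpan {e : Fin r → ι → ℂ} (he : LinearIndependent ℂ e) {j : ℕ} (hj : j ≤ r) :
    Module.finrank ℂ (frameSpan e j) = j := by
  rw [frameSpan_eq_span_range e hj, finrank_span_eq_card]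
  · simp
  · exact he.comp _ (Fin.castLE_injective hj)

theorem isCompleteFlag_frameSpan {e : Fin r → ι → ℂ} (he : LinearIndependent ℂ e)
    {E : Submodule ℂ (ι → ℂ)} (hE : ∀ i, e i ∈ E) (hr : Module.finrank ℂ E = r) :
    IsCompleteFlag E r (frameSpan e) := by
  refine ⟨fun j hj => finrank_frameSpan he hj, fun j _ => frameSpan_mono e j.le_succ, ?_⟩
  refine Submodule.eq_of_le_of_finrank_eq (frameSpan_le.2 fun i _ => hE i) ?_
  rw [finrank_frameSpan he le_rfl, hr]

theorem isCompact_isOrthonormalFrame : IsCompact {e : Fin r → ι → ℂ | IsOrthonormalFrame e} := by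
  have hK : IsCompact (Set.univ.pi fun _ : Fin r => Set.univ.pi fun _ : ι =>
      Metric.closedBall (0 : ℂ) 1) :=
    isCompact_univ_pi fun _ => isCompact_univ_pi fun _ => isCompact_closedBall 0 1
  refine hK.of_isClosed_subset ?_ ?_
  · simp only [IsOrthonormalFrame, Set.ofPred_forall]
    refine isClosed_iInter fun i => isClosed_iInter fun j => isClosed_eq ?_ continuous_const
    unfold dotProduct
    simp only [Pi.star_apply]
    fun_prop
  · intro e he i _ k _
    rw [mem_closedBall_zero_iff]
    have h1 := he i i
    have h2 : star (e i) ⬝ᵥ e i = ((∑ k, ‖e i k‖ ^ 2 : ℝ) : ℂ) := by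
      simp [dotProduct, Complex.conj_mul']
    rw [h2, if_pos rfl] at h1
    have h3 : ∑ k, ‖e i k‖ ^ 2 = 1 := by exact_mod_cast h1
    have h4 : ‖e i k‖ ^ 2 ≤ 1 :=
      h3 ▸ Finset.single_le_sum (f := fun k => ‖e i k‖ ^ 2) (fun k _ => sq_nonneg _)
        (Finset.mem_univ k)
    nlinarith [norm_nonneg (e i k)]

theorem exists_unit_orthogonal {N M : Submodule ℂ (ι → ℂ)} (h : N < M) :
    ∃ v ∈ M, star v ⬝ᵥ v = 1 ∧ ∀ w ∈ N, star w ⬝ᵥ v = 0 := by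
  let φ : (ι → ℂ) ≃ₗ[ℂ] EuclideanSpace ℂ ι := (WithLp.linearEquiv 2 ℂ (ι → ℂ)).symm
  let N' := N.map φ.toLinearMap
  let M' := M.map φ.toLinearMap
  have hlt : N' < M' := Submodule.map_strictMono_of_injective φ.injective h
  have hne : N'ᗮ ⊓ M' ≠ ⊥ := fun h0 => by
    have := Submodule.sup_orthogonal_inf_of_hasOrthogonalProjection hlt.le
    rw [h0, sup_bot_eq] at this
    exact hlt.ne this
  obtain ⟨u, ⟨huN, v, hv, rfl⟩, hu0⟩ := Submodule.exists_mem_ne_zero_of_ne_bot hne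
  have hnorm : (‖φ v‖ : ℂ) ≠ 0 := by
    simpa using hu0
  have hinner : ∀ a b : ι → ℂ, inner ℂ (φ a) (φ b) = star a ⬝ᵥ b := fun a b => by
    rw [EuclideanSpace.inner_eq_star_dotProduct, dotProduct_comm]
    rfl
  refine ⟨(‖φ v‖ : ℂ)⁻¹ • v, M.smul_mem _ hv, ?_, fun w hw => ?_⟩
  · rw [← hinner, map_smul, inner_smul_left, inner_smul_right, inner_self_eq_norm_sq_to_K]
    simp only [map_inv₀, Complex.conj_ofReal]
    field_simp
    simp
  · have h1 : inner ℂ (φ w) (φ v) = 0 := huN _ ⟨w, hw, rfl⟩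
    rw [← hinner, map_smul, inner_smul_right, h1, mul_zero]

omit [Fintype ι] in
theorem IsCompleteFlag.mono {E : Submodule ℂ (ι → ℂ)} {F : ℕ → Submodule ℂ (ι → ℂ)}
    (hF : IsCompleteFlag E r F) {j k : ℕ} (hjk : j ≤ k) (hk : k ≤ r) : F j ≤ F k := by
  induction k, hjk using Nat.le_induction with
  | base => exact le_rfl
  | succ k _ ih => exact (ih (Nat.le_of_succ_le hk)).trans (hF.2.1 k hk)

/-- Every complete flag is the flag of an orthonormal frame. -/
theorem IsCompleteFlag.exists_frame {E : Submodule ℂ (ι → ℂ)} {F : ℕ → Submodule ℂ (ι → ℂ)}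
    (hF : IsCompleteFlag E r F) :
    ∃ e : Fin r → ι → ℂ, IsOrthonormalFrame e ∧ ∀ j ≤ r, frameSpan e j = F j := by
  have hlt : ∀ i : Fin r, F i < F (i + 1) := fun i =>
    lt_of_le_of_ne (hF.2.1 i i.2) fun h => by
      have h1 := hF.1 i i.2.le
      rw [h, hF.1 _ i.2] at h1
      omega
  choose e heM he1 heN using fun i => exists_unit_orthogonal (hlt i)
  have hon : IsOrthonormalFrame e := by
    have hlt' : ∀ i j : Fin r, i < j → star (e i) ⬝ᵥ e j = 0 := fun i j hij =>
      heN j _ (hF.mono hij j.2.le (heM i))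
    intro i j
    rcases lt_trichotomy i j with h | h | h
    · rw [if_neg h.ne, hlt' i j h]
    · rw [if_pos h, h, he1]
    · rw [if_neg h.ne', Matrix.star_dotProduct, hlt' j i h, star_zero]
  refine ⟨e, hon, fun j hj => Submodule.eq_of_le_of_finrank_eq (frameSpan_le.2 fun i hi =>
    hF.mono hi hj (heM i)) ?_⟩
  rw [finrank_frameSpan hon.linearIndependent hj, hF.1 j hj]

theorem exists_submodule_succ {N : Submodule ℂ (ι → ℂ)} (x : ι → ℂ)
    (h : Module.finrank ℂ N < Fintype.card ι) :
    ∃ N' : Submodule ℂ (ι → ℂ), N ≤ N' ∧ x ∈ N' ∧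
      Module.finrank ℂ N' = Module.finrank ℂ N + 1 := by
  by_cases hx : x ∈ N
  · have hN : N ≠ ⊤ := fun h0 => by
      rw [h0, finrank_top, Module.finrank_fintype_fun_eq_card] at h
      exact lt_irrefl _ h
    obtain ⟨v, -, hv⟩ := SetLike.exists_of_lt hN.lt_top
    exact ⟨N ⊔ Submodule.span ℂ {v}, le_sup_left, Submodule.mem_sup_left hx,
      Submodule.finrank_sup_span_singleton hv⟩
  · exact ⟨N ⊔ Submodule.span ℂ {x}, le_sup_left,
      Submodule.mem_sup_right (Submodule.mem_span_singleton_self x),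
      Submodule.finrank_sup_span_singleton hx⟩

/-- Any sequence of vectors is adapted to some complete flag. -/
theorem exists_flag_of_vectors (x : ℕ → ι → ℂ) :
    ∃ W : ℕ → Submodule ℂ (ι → ℂ), IsCompleteFlag ⊤ (Fintype.card ι) W ∧
      ∀ i < Fintype.card ι, x i ∈ W (i + 1) := by
  classical
  have hstep : ∀ (N : Submodule ℂ (ι → ℂ)) (v : ι → ℂ), ∃ N' : Submodule ℂ (ι → ℂ),
      Module.finrank ℂ N < Fintype.card ι → N ≤ N' ∧ v ∈ N' ∧
        Module.finrank ℂ N' = Module.finrank ℂ N + 1 := fun N v => by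
    by_cases h : Module.finrank ℂ N < Fintype.card ι
    · obtain ⟨N', h'⟩ := exists_submodule_succ v h
      exact ⟨N', fun _ => h'⟩
    · exact ⟨N, fun h' => absurd h' h⟩
  choose next hnext using hstep
  obtain ⟨W, hW0, hW⟩ : ∃ W : ℕ → Submodule ℂ (ι → ℂ), W 0 = ⊥ ∧ ∀ i, W (i + 1) = next (W i) (x i) :=
    ⟨fun n => Nat.rec ⊥ (fun i N => next N (x i)) n, rfl, fun _ => rfl⟩
  have hrank : ∀ j ≤ Fintype.card ι, Module.finrank ℂ (W j) = j := by
    intro j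
    induction j with
    | zero =>
      intro _
      rw [hW0, finrank_bot]
    | succ j ih =>
      intro hj
      have hj' : Module.finrank ℂ (W j) = j := ih (Nat.le_of_succ_le hj)
      rw [hW]
      have := (hnext (W j) (x j) (hj'.trans_lt hj)).2.2
      rwa [hj'] at this
  refine ⟨W, ⟨hrank, fun j hj => ?_, ?_⟩, fun i hi => ?_⟩
  · rw [hW]
    exact (hnext (W j) (x j) (by rwa [hrank j hj.le])).1
  · exact Submodule.eq_top_of_finrank_eq (by rw [hrank _ le_rfl, Module.finrank_fintype_fun_eq_card])
  · rw [hW]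
    exact (hnext (W i) (x i) (by rwa [hrank i hi.le])).2.1

end Frames

/-! ### Flags in limits of spans of rank one tensors -/

section SecantFlags

variable {m r : ℕ} {d : Fin 3 → ℕ}

theorem act_power (g : GL3 m) (x : Point m) :
    act d g (power d x) = power d fun p => (g p : Matrix (Fin m) (Fin m) ℂ).mulVecLin (x p) := by
  ext i
  have h : ∀ p, ∏ q, ((g p : Matrix (Fin m) (Fin m) ℂ).mulVecLin (x p)) (i p q) =
      ∑ k : Fin (d p) → Fin m,
        ∏ q, (g p : Matrix (Fin m) (Fin m) ℂ) (i p q) (k q) * x p (k q) := by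
    intro p
    simp only [Matrix.mulVecLin_apply, Matrix.mulVec, dotProduct]
    rw [Finset.prod_univ_sum, Fintype.piFinset_univ]
  have hl : act d g (power d x) i =
      ∑ j : Idx m d, (∏ p, ∏ q, (g p : Matrix (Fin m) (Fin m) ℂ) (i p q) (j p q)) *
        ∏ p, ∏ q, x p (j p q) := rfl
  have hr : (power d fun p => (g p : Matrix (Fin m) (Fin m) ℂ).mulVecLin (x p)) i =
      ∏ p, ∏ q, ((g p : Matrix (Fin m) (Fin m) ℂ).mulVecLin (x p)) (i p q) := rfl
  rw [hl, hr, Finset.prod_congr rfl fun p _ => h p, Finset.prod_univ_sum, Fintype.piFinset_univ]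
  simp only [Finset.prod_mul_distrib]

theorem act_injective (g : GL3 m) : Function.Injective (act d g) := by
  intro X Y h
  rw [← act_one d X, ← act_one d Y, ← inv_mul_cancel g, act_mul, act_mul, h]

theorem continuous_act (g : GL3 m) : Continuous (act d g) :=
  LinearMap.continuous_of_finiteDimensional _

theorem mulVecLin_injective (g : Matrix.GeneralLinearGroup (Fin m) ℂ) :
    Function.Injective (g : Matrix (Fin m) (Fin m) ℂ).mulVecLin := by
  intro v w h
  have := congrArg (g⁻¹ : Matrix.GeneralLinearGroup (Fin m) ℂ).1.mulVecLin h
  simp only [Matrix.mulVecLin_apply, Matrix.mulVec_mulVec] at this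
  rwa [Units.inv_mul, Matrix.one_mulVec, Matrix.one_mulVec] at this

theorem act_mem_symTens (g : GL3 m) {W : Fin 3 → Submodule ℂ (Fin m → ℂ)} {X : Tens m d}
    (hX : X ∈ symTens W d) :
    act d g X ∈ symTens (fun p => (W p).map (g p : Matrix (Fin m) (Fin m) ℂ).mulVecLin) d := by
  rw [← Submodule.mem_comap]
  refine (Submodule.span_le.2 ?_ : symTens W d ≤ _) hX
  rintro _ ⟨x, hx, rfl⟩
  exact Submodule.subset_span ⟨_, fun p => Submodule.mem_map_of_mem (hx p), act_power g x⟩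

theorem symTens_mono {W W' : Fin 3 → Submodule ℂ (Fin m → ℂ)} (h : ∀ p, W p ≤ W' p) :
    symTens W d ≤ symTens W' d := by
  refine Submodule.span_mono ?_
  rintro _ ⟨x, hx, rfl⟩
  exact ⟨x, fun p => h p (hx p), rfl⟩

/-- The `n`-tuples in `A^{⊗ s} ⊗ B^{⊗ t} ⊗ C^{⊗ u}` whose entries lie in the span of `k` common
powers `a^s ⊗ b^t ⊗ c^u`. -/
def secantTuples (m : ℕ) (d : Fin 3 → ℕ) (n k : ℕ) : Set (Fin n → Tens m d) :=
  {t' | ∃ (x : Fin k → Point m) (c : Fin k → Fin n → ℂ),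
    t' = ∑ i, fun l => c i l • power d (x i)}

theorem combination_mem_closure_secantTuples {n n' k : ℕ} {t : Fin n → Tens m d}
    (ht : t ∈ closure (secantTuples m d n k)) (L : Fin n' → Fin n → ℂ) :
    (fun l => ∑ i, L l i • t i) ∈ closure (secantTuples m d n' k) := by
  refine map_mem_closure (f := fun t : Fin n → Tens m d => fun l => ∑ i, L l i • t i)
    (by fun_prop) ht ?_
  rintro _ ⟨x, c, rfl⟩
  refine ⟨x, fun i l => ∑ i', L l i' * c i i', ?_⟩
  ext l : 1
  simp only [Finset.sum_apply, Finset.smul_sum, Finset.sum_smul, smul_smul]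
  rw [Finset.sum_comm]

theorem act_mem_closure_secantTuples {n k : ℕ} {t : Fin n → Tens m d}
    (ht : t ∈ closure (secantTuples m d n k)) (g : GL3 m) :
    (fun l => act d g (t l)) ∈ closure (secantTuples m d n k) := by
  refine map_mem_closure (f := fun t : Fin n → Tens m d => fun l => act d g (t l))
    (continuous_pi fun l => (continuous_act g).comp (continuous_apply l)) ht ?_
  rintro _ ⟨x, c, rfl⟩
  refine ⟨fun i p => (g p : Matrix (Fin m) (Fin m) ℂ).mulVecLin (x i p), c, ?_⟩
  ext l : 1
  simp only [Finset.sum_apply, map_sum, map_smul, act_power]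

/-- Complete flags `F` in `E` and `W 0`, `W 1`, `W 2` in `A`, `B`, `C` with the properties that the
flag conditions ask for, in a form that is invariant under the group and closed. -/
structure IsSecantFlag (E : Submodule ℂ (Tens m d)) (r : ℕ) (F : ℕ → Submodule ℂ (Tens m d))
    (W : Fin 3 → ℕ → Submodule ℂ (Fin m → ℂ)) : Prop where
  flag : IsCompleteFlag E r F
  flags : ∀ p, IsCompleteFlag (⊤ : Submodule ℂ (Fin m → ℂ)) m (W p)
  secant : ∀ j ≤ r, ∀ (n : ℕ) (t : Fin n → Tens m d), (∀ l, t l ∈ F j) →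
    t ∈ closure (secantTuples m d n j)
  sym : ∀ j ≤ r, j ≤ m → F j ≤ symTens (fun p => W p j) d

/-- The pairs of orthonormal frames of flags as in `IsSecantFlag`. -/
def secantFrames (m r : ℕ) (d : Fin 3 → ℕ) :
    Set ((Fin r → Tens m d) × (Fin 3 → Fin m → Fin m → ℂ)) :=
  {y | IsOrthonormalFrame y.1 ∧ (∀ p, IsOrthonormalFrame (y.2 p)) ∧
    (∀ (j : ℕ) (hj : j ≤ r), (fun i : Fin j => y.1 (Fin.castLE hj i)) ∈
      closure (secantTuples m d j j)) ∧
    ∀ i : Fin r, (i : ℕ) < m → y.1 i ∈ symTens (fun p => frameSpan (y.2 p) (i + 1)) d}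

theorem isSecantFlag_frameSpan {y : (Fin r → Tens m d) × (Fin 3 → Fin m → Fin m → ℂ)}
    (hy : y ∈ secantFrames m r d) {E : Submodule ℂ (Tens m d)} (hE : Module.finrank ℂ E = r)
    (hyE : ∀ i, y.1 i ∈ E) :
    IsSecantFlag E r (frameSpan y.1) fun p => frameSpan (y.2 p) where
  flag := isCompleteFlag_frameSpan hy.1.linearIndependent hyE hE
  flags p := isCompleteFlag_frameSpan (hy.2.1 p).linearIndependent (fun _ => trivial) (by simp)
  secant j hj n t ht := by
    have h : ∀ l, ∃ c : Fin j → ℂ, ∑ i, c i • y.1 (Fin.castLE hj i) = t l := fun l => by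
      have := ht l
      rwa [frameSpan_eq_span_range _ hj, Submodule.mem_span_range_iff_exists_fun] at this
    choose L hL using h
    rw [← funext hL]
    exact combination_mem_closure_secantTuples (hy.2.2.1 j hj) L
  sym j _ hjm := frameSpan_le.2 fun i hi =>
    symTens_mono (fun p => frameSpan_mono _ hi) (hy.2.2.2 i (hi.trans_le hjm))

theorem IsSecantFlag.mem_secantFrames {E : Submodule ℂ (Tens m d)} {F : ℕ → Submodule ℂ (Tens m d)}
    {W : Fin 3 → ℕ → Submodule ℂ (Fin m → ℂ)} (h : IsSecantFlag E r F W) {e : Fin r → Tens m d}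
    (he : IsOrthonormalFrame e) (heF : ∀ j ≤ r, frameSpan e j = F j)
    {w : Fin 3 → Fin m → Fin m → ℂ} (hw : ∀ p, IsOrthonormalFrame (w p))
    (hwW : ∀ p, ∀ j ≤ m, frameSpan (w p) j = W p j) : (e, w) ∈ secantFrames m r d := by
  refine ⟨he, hw, fun j hj => h.secant j hj j _ fun l => ?_, fun i hi => ?_⟩
  · rw [← heF j hj]
    exact mem_frameSpan e l.2
  · have := h.sym (i + 1) i.2 hi (by rw [← heF _ i.2]; exact mem_frameSpan e (Nat.lt_succ_self _))
    have hWp : (fun p => frameSpan (w p) (i + 1)) = fun p => W p (i + 1) :=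
      funext fun p => hwW p _ hi
    exact hWp ▸ this

theorem IsSecantFlag.exists_frames {E : Submodule ℂ (Tens m d)} {F : ℕ → Submodule ℂ (Tens m d)}
    {W : Fin 3 → ℕ → Submodule ℂ (Fin m → ℂ)} (h : IsSecantFlag E r F W) :
    ∃ y ∈ secantFrames m r d, (∀ i, y.1 i ∈ E) ∧ ∀ j ≤ r, frameSpan y.1 j = F j := by
  obtain ⟨e, he, heF⟩ := h.flag.exists_frame
  choose w hw hwW using fun p => (h.flags p).exists_frame
  refine ⟨(e, w), h.mem_secantFrames he heF hw hwW, fun i => ?_, heF⟩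
  have := mem_frameSpan e i.2
  rwa [heF r le_rfl, h.flag.2.2] at this

theorem IsSecantFlag.map {E : Submodule ℂ (Tens m d)} {F : ℕ → Submodule ℂ (Tens m d)}
    {W : Fin 3 → ℕ → Submodule ℂ (Fin m → ℂ)} (h : IsSecantFlag E r F W) (g : GL3 m)
    (hE : E.map (act d g) = E) :
    IsSecantFlag E r (fun j => (F j).map (act d g))
      fun p j => (W p j).map (g p : Matrix (Fin m) (Fin m) ℂ).mulVecLin where
  flag := by
    refine ⟨fun j hj => ?_, fun j hj => Submodule.map_mono (h.flag.2.1 j hj), ?_⟩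
    · conv_rhs => rw [← h.flag.1 j hj]
      exact (Submodule.equivMapOfInjective _ (act_injective g) (F j)).finrank_eq.symm
    · simp only [h.flag.2.2, hE]
  flags p := by
    have hr : ∀ j ≤ m, Module.finrank ℂ
        ((W p j).map (g p : Matrix (Fin m) (Fin m) ℂ).mulVecLin) = j := fun j hj => by
      conv_rhs => rw [← (h.flags p).1 j hj]
      exact (Submodule.equivMapOfInjective _ (mulVecLin_injective (g p)) (W p j)).finrank_eq.symm
    refine ⟨hr, fun j hj => Submodule.map_mono ((h.flags p).2.1 j hj), ?_⟩
    exact Submodule.eq_top_of_finrank_eq (by rw [hr m le_rfl]; simp)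
  secant j hj n t ht := by
    choose u hu hut using ht
    rw [← funext hut]
    exact act_mem_closure_secantTuples (h.secant j hj n u hu) g
  sym j hj hjm := by
    rintro _ ⟨X, hX, rfl⟩
    exact act_mem_symTens g (h.sym j hj hjm hX)

/-- The element of `GL(A) × GL(B) × GL(C)` whose columns form given orthonormal bases. -/
def frameGL (w : Fin 3 → Fin m → Fin m → ℂ) (hw : ∀ p, IsOrthonormalFrame (w p)) : GL3 m := fun p =>
  have h : (Matrix.of (w p)).map star * (Matrix.of (w p)).transpose = 1 := by
    ext i j
    rw [Matrix.one_apply, ← hw p i j]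
    rfl
  ⟨(Matrix.of (w p)).transpose, (Matrix.of (w p)).map star, mul_eq_one_comm.1 h, h⟩

theorem map_mulVecLin_frameSpan (M : Matrix (Fin m) (Fin m) ℂ) (w : Fin m → Fin m → ℂ) (j : ℕ) :
    (frameSpan w j).map M.mulVecLin = frameSpan (fun i => M.mulVecLin (w i)) j := by
  rw [frameSpan, frameSpan, Submodule.map_span, Set.image_image]

/-- The condition `X ∈ S^s A_k ⊗ S^t B_k ⊗ S^u C_k` is closed in `X` and the orthonormal frames of
the flags: applying the inverses of the unitary matrices of the frames, it becomes membership in a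
fixed subspace. -/
theorem isClosed_mem_symTens_frameSpan (k : ℕ) :
    IsClosed {z : Tens m d × (Fin 3 → Fin m → Fin m → ℂ) | (∀ p, IsOrthonormalFrame (z.2 p)) ∧
      z.1 ∈ symTens (fun p => frameSpan (z.2 p) k) d} := by
  let std : Fin m → Fin m → ℂ := fun i => Pi.single i 1
  let Ψ : Tens m d × (Fin 3 → Fin m → Fin m → ℂ) → Tens m d := fun z i =>
    ∑ j, (∏ p, ∏ q, star (z.2 p (i p q) (j p q))) * z.1 j
  have hΨ : Continuous Ψ := by
    refine continuous_pi fun i => continuous_finsetSum _ fun j _ => ?_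
    refine (continuous_finsetProd _ fun p _ => continuous_finsetProd _ fun q _ => ?_).mul ?_
    · fun_prop
    · fun_prop
  have hact : ∀ z (hz : ∀ p, IsOrthonormalFrame (z.2 p)), Ψ z = act d (frameGL z.2 hz)⁻¹ z.1 :=
    fun z hz => rfl
  have hcol : ∀ (w : Fin 3 → Fin m → Fin m → ℂ) (hw : ∀ p, IsOrthonormalFrame (w p)) (p : Fin 3)
      (i : Fin m), (frameGL w hw p : Matrix (Fin m) (Fin m) ℂ).mulVecLin (std i) = w p i := by
    intro w hw p i
    rw [Matrix.mulVecLin_apply, Matrix.mulVec_single_one]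
    rfl
  have hcol' : ∀ (w : Fin 3 → Fin m → Fin m → ℂ) (hw : ∀ p, IsOrthonormalFrame (w p)) (p : Fin 3)
      (i : Fin m),
      ((frameGL w hw)⁻¹ p : Matrix (Fin m) (Fin m) ℂ).mulVecLin (w p i) = std i := by
    intro w hw p i
    rw [← hcol w hw p i, Matrix.mulVecLin_apply, Matrix.mulVecLin_apply, Matrix.mulVec_mulVec]
    rw [Pi.inv_apply, Units.inv_mul, Matrix.one_mulVec]
  have hset : {z : Tens m d × (Fin 3 → Fin m → Fin m → ℂ) | (∀ p, IsOrthonormalFrame (z.2 p)) ∧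
      z.1 ∈ symTens (fun p => frameSpan (z.2 p) k) d} =
      {z | ∀ p, IsOrthonormalFrame (z.2 p)} ∩
        Ψ ⁻¹' (symTens (fun _ => frameSpan std k) d : Set (Tens m d)) := by
    ext z
    refine and_congr_right fun hz => ?_
    rw [Set.mem_preimage, SetLike.mem_coe, hact z hz]
    constructor
    · intro h
      have := act_mem_symTens (frameGL z.2 hz)⁻¹ h
      simp only [map_mulVecLin_frameSpan, hcol' z.2 hz] at this
      exact this
    · intro h
      have := act_mem_symTens (frameGL z.2 hz) h
      simp only [map_mulVecLin_frameSpan, hcol z.2 hz] at this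
      rwa [← act_mul, mul_inv_cancel, act_one] at this
  rw [hset]
  refine IsClosed.inter ?_ ((Submodule.closed_of_finiteDimensional _).preimage hΨ)
  rw [Set.ofPred_forall]
  exact isClosed_iInter fun p =>
    isCompact_isOrthonormalFrame.isClosed.preimage (by fun_prop)

theorem isCompact_secantFrames : IsCompact (secantFrames m r d) := by
  have hK : IsCompact ({e : Fin r → Tens m d | IsOrthonormalFrame e} ×ˢ
      Set.univ.pi fun _ : Fin 3 => {w : Fin m → Fin m → ℂ | IsOrthonormalFrame w}) :=
    isCompact_isOrthonormalFrame.prod (isCompact_univ_pi fun _ => isCompact_isOrthonormalFrame)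
  have hset : secantFrames m r d = ({e : Fin r → Tens m d | IsOrthonormalFrame e} ×ˢ
      Set.univ.pi fun _ : Fin 3 => {w : Fin m → Fin m → ℂ | IsOrthonormalFrame w}) ∩
      ((⋂ (j : ℕ) (hj : j ≤ r), {y | (fun i : Fin j => y.1 (Fin.castLE hj i)) ∈
        closure (secantTuples m d j j)}) ∩
      ⋂ (i : Fin r) (_ : (i : ℕ) < m), {y | (∀ p, IsOrthonormalFrame (y.2 p)) ∧
        y.1 i ∈ symTens (fun p => frameSpan (y.2 p) (i + 1)) d}) := by
    ext y
    simp only [secantFrames, Set.mem_ofPred_eq, Set.mem_inter_iff, Set.mem_prod, Set.mem_pi,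
      Set.mem_univ, true_implies, Set.mem_iInter]
    constructor
    · rintro ⟨h1, h2, h3, h4⟩
      exact ⟨⟨h1, h2⟩, h3, fun i hi => ⟨h2, h4 i hi⟩⟩
    · rintro ⟨⟨h1, h2⟩, h3, h4⟩
      exact ⟨h1, h2, h3, fun i hi => (h4 i hi).2⟩
  rw [hset]
  refine hK.inter_right (IsClosed.inter ?_ ?_)
  · exact isClosed_iInter fun j => isClosed_iInter fun hj => isClosed_closure.preimage (by fun_prop)
  · refine isClosed_iInter fun i => isClosed_iInter fun _ => ?_
    exact (isClosed_mem_symTens_frameSpan (m := m) (d := d) (i + 1)).preimage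
      (f := fun y : (Fin r → Tens m d) × (Fin 3 → Fin m → Fin m → ℂ) => (y.1 i, y.2)) (by fun_prop)

/-- The Borel fixed point theorem for a compact set `Y` of frames whose flags form a stable set of
complete flags: the flag of some frame is fixed. The subspaces are fixed one at a time; a subspace
`F (j + 1)` containing a fixed `F j` is a line in the quotient by `F j`. -/
theorem exists_fixed_frame {T : Type*} [TopologicalSpace T] (e : T → Fin r → Tens m d)
    (he : Continuous e) {B : Subgroup (GL3 m)} (hB : IsZariskiClosed (B : Set (GL3 m)))
    (hB' : IsZariskiConnected (B : Set (GL3 m))) (hB'' : Group.IsSolvable B) (Y : Set T)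
    (hY : IsCompact Y) (hne : Y.Nonempty) (hind : ∀ y ∈ Y, LinearIndependent ℂ (e y))
    (hst : ∀ y ∈ Y, ∀ g ∈ B, ∃ y' ∈ Y, ∀ j ≤ r,
      frameSpan (e y') j = (frameSpan (e y) j).map (act d g)) :
    ∃ y ∈ Y, ∀ j ≤ r, IsFixed B (frameSpan (e y) j) := by
  suffices h : ∀ k ≤ r, ∃ (Z : Set T) (F : ℕ → Submodule ℂ (Tens m d)), Z ⊆ Y ∧ IsCompact Z ∧
      Z.Nonempty ∧ (∀ y ∈ Z, ∀ j ≤ k, frameSpan (e y) j = F j) ∧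
      ∀ y ∈ Z, ∀ g ∈ B, ∃ y' ∈ Z, ∀ j ≤ r,
        frameSpan (e y') j = (frameSpan (e y) j).map (act d g) by
    obtain ⟨Z, F, hZY, -, ⟨y, hy⟩, hF, hZ⟩ := h r le_rfl
    refine ⟨y, hZY hy, fun j hj g hg => ?_⟩
    obtain ⟨y', hy', h'⟩ := hZ y hy g hg
    rw [← h' j hj, hF y' hy' j hj, hF y hy j hj]
  intro k
  induction k with
  | zero =>
    intro _
    refine ⟨Y, fun _ => ⊥, le_rfl, hY, hne, fun y _ j hj => ?_, hst⟩
    rw [Nat.le_zero.1 hj, eq_bot_iff, frameSpan_le]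
    exact fun i hi => absurd hi (Nat.not_lt_zero _)
  | succ k ih =>
    intro hk
    obtain ⟨Z, F, hZY, hZ, hZne, hF, hZst⟩ := ih (Nat.le_of_succ_le hk)
    let i : Fin r := ⟨k, hk⟩
    have hsucc : ∀ y ∈ Z, frameSpan (e y) (k + 1) = F k ⊔ Submodule.span ℂ {e y i} := fun y hy => by
      rw [← hF y hy k le_rfl]
      exact frameSpan_succ (e y) i
    have hFk : ∀ g ∈ B, (F k).map (act d g) = F k := fun g hg => by
      obtain ⟨y, hy⟩ := hZne
      obtain ⟨y', hy', h'⟩ := hZst y hy g hg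
      have := h' k (Nat.le_of_succ_le hk)
      rwa [hF y' hy' k le_rfl, hF y hy k le_rfl, eq_comm] at this
    have hFmem : ∀ g : B, ∀ v ∈ F k, actHom B d g v ∈ F k := fun g v hv =>
      hFk g g.2 ▸ Submodule.mem_map_of_mem hv
    have hnot : ∀ y ∈ Z, e y i ∉ F k := fun y hy hmem => by
      have h1 := finrank_frameSpan (hind y (hZY hy)) hk
      have h2 := finrank_frameSpan (hind y (hZY hy)) (Nat.le_of_succ_le hk)
      rw [hsucc y hy, sup_eq_left.2 ((Submodule.span_singleton_le_iff_mem _ _).2 hmem),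
        ← hF y hy k le_rfl, h2] at h1
      omega
    obtain ⟨y₀, hy₀, hfix⟩ := exists_fixed_line (regularFunctions B) (actHom B d)
      (fun y => e y i)
      (fun l => (LinearMap.continuous_of_finiteDimensional l).comp
        ((continuous_apply i).comp he))
      (actHom_isRational B d) (regularFunctions_isConnected hB') hB''
      (fun f hf hbdd g => regularFunctions_isConnected hB' f hf
        ((finite_range_of_bounded hB hf hbdd).subset (Set.image_subset_range _ _)) g trivial)
      hFmem ⊤ le_top (fun _ _ _ => trivial) Z hZ hZne (fun _ _ => trivial) hnot
      (by
        intro y hy g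
        obtain ⟨y', hy', h'⟩ := hZst y hy g g.2
        refine ⟨y', hy', ?_⟩
        have hmem : actHom B d g (e y i) ∈ frameSpan (e y') (k + 1) := by
          rw [h' _ hk]
          exact Submodule.mem_map_of_mem (mem_frameSpan (e y) (Nat.lt_succ_self k))
        rw [hsucc y' hy'] at hmem
        obtain ⟨v, hv, u, hu, huv⟩ := Submodule.mem_sup.1 hmem
        obtain ⟨c, rfl⟩ := Submodule.mem_span_singleton.1 hu
        exact ⟨c, by rwa [← huv, add_sub_cancel_right]⟩)
    let N := F k ⊔ Submodule.span ℂ {e y₀ i}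
    have hNg : ∀ g ∈ B, N.map (act d g) ≤ N := by
      intro g hg
      rw [Submodule.map_sup, hFk g hg]
      refine sup_le le_sup_left ?_
      rw [Submodule.map_span, Set.image_singleton, Submodule.span_singleton_le_iff_mem]
      obtain ⟨c, hc⟩ := hfix ⟨g, hg⟩
      have : act d g (e y₀ i) = (act d g (e y₀ i) - c • e y₀ i) + c • e y₀ i := by abel
      rw [this]
      exact Submodule.add_mem_sup hc
        (Submodule.smul_mem _ _ (Submodule.mem_span_singleton_self _))
    have hspan : ∀ y ∈ Z, e y i ∈ N → frameSpan (e y) (k + 1) = N := fun y hy hmem => by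
      refine Submodule.eq_of_le_of_finrank_eq ?_ ?_
      · rw [hsucc y hy]
        exact sup_le le_sup_left ((Submodule.span_singleton_le_iff_mem _ _).2 hmem)
      · rw [finrank_frameSpan (hind y (hZY hy)) hk]
        exact (hsucc y₀ hy₀ ▸ finrank_frameSpan (hind y₀ (hZY hy₀)) hk).symm
    refine ⟨Z ∩ {y | e y i ∈ N}, fun j => if j ≤ k then F j else N,
      Set.inter_subset_left.trans hZY, hZ.inter_right ?_, ⟨y₀, hy₀, ?_⟩, ?_, ?_⟩
    · exact (Submodule.closed_of_finiteDimensional N).preimage ((continuous_apply i).comp he)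
    · exact Submodule.mem_sup_right (Submodule.mem_span_singleton_self _)
    · rintro y ⟨hy, hyN⟩ j hj
      rcases Nat.le_succ_iff.1 hj with h | rfl
      · simp only [h, if_true, hF y hy j h]
      · simp only [Nat.not_succ_le_self, if_false, hspan y hy hyN]
    · rintro y ⟨hy, hyN⟩ g hg
      obtain ⟨y', hy', h'⟩ := hZst y hy g hg
      refine ⟨y', ⟨hy', ?_⟩, h'⟩
      have hmem : e y' i ∈ frameSpan (e y') (k + 1) := mem_frameSpan (e y') (Nat.lt_succ_self k)
      rw [h' _ hk, hspan y hy hyN] at hmem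
      exact hNg g hg hmem

/-- If some flag in `E` satisfies the conditions, and `E` is fixed by a closed connected solvable
group, then so does some flag of subspaces fixed by the group. -/
theorem exists_fixed_secantFlag {E : Submodule ℂ (Tens m d)} (hE : Module.finrank ℂ E = r)
    (hne : ∃ y ∈ secantFrames m r d, ∀ i, y.1 i ∈ E) {B : Subgroup (GL3 m)}
    (hB : IsZariskiClosed (B : Set (GL3 m))) (hB' : IsZariskiConnected (B : Set (GL3 m)))
    (hB'' : Group.IsSolvable B) :
    ∃ F W, IsSecantFlag E r F W ∧ (IsFixed B E → ∀ j ≤ r, IsFixed B (F j)) := by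
  obtain ⟨y₀, hy₀, hy₀E⟩ := hne
  by_cases hfix : IsFixed B E
  · have hclosed : IsClosed {y : (Fin r → Tens m d) × (Fin 3 → Fin m → Fin m → ℂ) |
        ∀ i, y.1 i ∈ E} := by
      rw [Set.ofPred_forall]
      exact isClosed_iInter fun i =>
        (Submodule.closed_of_finiteDimensional E).preimage (by fun_prop)
    obtain ⟨y, ⟨hy, hyE⟩, hyfix⟩ := exists_fixed_frame (fun y => y.1) continuous_fst hB hB' hB''
      (secantFrames m r d ∩ {y | ∀ i, y.1 i ∈ E}) (isCompact_secantFrames.inter_right hclosed)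
      ⟨y₀, hy₀, hy₀E⟩ (fun y hy => hy.1.1.linearIndependent) (by
        rintro y ⟨hy, hyE⟩ g hg
        obtain ⟨y', hy', hyE', h'⟩ :=
          ((isSecantFlag_frameSpan hy hE hyE).map g (hfix g hg)).exists_frames
        exact ⟨y', ⟨hy', hyE'⟩, h'⟩)
    exact ⟨_, _, isSecantFlag_frameSpan hy hE hyE, fun _ => hyfix⟩
  · exact ⟨_, _, isSecantFlag_frameSpan hy₀ hE hy₀E, fun h => absurd h hfix⟩

end SecantFlags

/-! ### Duality between tensors and polynomials -/

section Duality

variable {m r : ℕ} {d : Fin 3 → ℕ}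

/-- The exponent of the monomial that corresponds to an index. -/
noncomputable def exponent (i : Idx m d) : Fin 3 × Fin m →₀ ℕ := ∑ p, ∑ q, Finsupp.single (p, i p q) 1

theorem toPoly_eq (f : Tens m d) : toPoly f = ∑ i, MvPolynomial.monomial (exponent i) (f i) := by
  refine Finset.sum_congr rfl fun i _ => ?_
  conv_rhs => rw [← mul_one (f i), ← MvPolynomial.C_mul_monomial, exponent,
    MvPolynomial.monomial_sum_one]
  simp only [MvPolynomial.monomial_sum_one, MvPolynomial.X]

/-- `toPoly` as a linear map. -/
noncomputable def toPolyLin (m : ℕ) (d : Fin 3 → ℕ) : Tens m d →ₗ[ℂ] CoordRing m where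
  toFun := toPoly
  map_add' f g := by simp [toPoly, add_mul, Finset.sum_add_distrib]
  map_smul' c f := by
    simp [toPoly, MvPolynomial.smul_eq_C_mul, Finset.mul_sum, mul_assoc]

theorem toPolyLin_apply (f : Tens m d) : toPolyLin m d f = toPoly f := rfl

theorem evalAt_toPoly (x : Point m) (f : Tens m d) : evalAt x (toPoly f) = f ⬝ᵥ power d x := by
  simp [evalAt, toPoly, dotProduct, power]

theorem weight_exponent (i : Idx m d) : Finsupp.weight (wt m) (exponent i) = d := by
  simp only [exponent, map_sum, Finsupp.weight_single, one_smul, wt, Finset.sum_const,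
    Finset.card_univ, Fintype.card_fin]
  ext p
  simp [Finset.sum_apply, Pi.single_apply]

theorem exists_exponent_eq {e : Fin 3 × Fin m →₀ ℕ} (he : Finsupp.weight (wt m) e = d) :
    ∃ i : Idx m d, exponent i = e := by
  classical
  have hd : ∀ p, ∑ k, e (p, k) = d p := fun p => by
    rw [← he, Finsupp.weight_apply, Finsupp.sum_fintype _ _ (by simp), Fintype.sum_prod_type]
    simp [Finset.sum_apply, wt, Pi.single_apply, Finset.sum_ite_eq]
  have hi : ∀ p, ∃ i : Fin (d p) → Fin m, ∀ k, (∑ q, if i q = k then 1 else 0) = e (p, k) := by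
    intro p
    have hcard : Fintype.card (Fin (d p)) = Fintype.card (Σ k : Fin m, Fin (e (p, k))) := by
      simp [hd p]
    let φ := Fintype.equivOfCardEq hcard
    refine ⟨fun q => (φ q).1, fun k => ?_⟩
    rw [φ.sum_comp (fun z : Σ k : Fin m, Fin (e (p, k)) => if z.1 = k then 1 else 0),
      Fintype.sum_sigma, Finset.sum_eq_single k]
    · simp
    · intro k' _ hk'
      simp [hk']
    · exact fun h => absurd (Finset.mem_univ k) h
  choose i hi using hi
  refine ⟨fun p => i p, ?_⟩
  ext ⟨p, k⟩
  rw [← hi p k, exponent, Finsupp.finsetSum_apply, Finset.sum_eq_single p]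
  · simp [Finsupp.finsetSum_apply, Finsupp.single_apply]
  · intro p' _ hp'
    simp [Finsupp.finsetSum_apply, hp']
  · exact fun h => absurd (Finset.mem_univ p) h

theorem toPoly_mem_component (f : Tens m d) : toPoly f ∈ component m d := by
  rw [toPoly_eq]
  exact Submodule.sum_mem _ fun i _ =>
    MvPolynomial.isWeightedHomogeneous_monomial _ _ _ (weight_exponent i)

/-- The symmetric tensor that represents a polynomial of degree `d`: each coefficient is distributed
evenly over the indices of its monomial. -/
noncomputable def toSym (d : Fin 3 → ℕ) (g : CoordRing m) : Tens m d := fun i =>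
  MvPolynomial.coeff (exponent i) g /
    (Finset.univ.filter fun i' : Idx m d => exponent i' = exponent i).card

theorem toPoly_toSym {g : CoordRing m} (hg : g ∈ component m d) : toPoly (toSym d g) = g := by
  classical
  ext e
  rw [toPoly_eq, MvPolynomial.coeff_sum]
  simp only [MvPolynomial.coeff_monomial]
  rw [← Finset.sum_filter]
  have h1 : ∀ i ∈ Finset.univ.filter (fun i : Idx m d => exponent i = e), toSym d g i =
      MvPolynomial.coeff e g / (Finset.univ.filter fun i : Idx m d => exponent i = e).card := by
    intro i hi
    rw [toSym, (Finset.mem_filter.1 hi).2]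
  rw [Finset.sum_congr rfl h1, Finset.sum_const, nsmul_eq_mul]
  by_cases h0 : MvPolynomial.coeff e g = 0
  · simp [h0]
  · obtain ⟨i, hi⟩ := exists_exponent_eq (hg h0)
    have hcard : ((Finset.univ.filter fun i : Idx m d => exponent i = e).card : ℂ) ≠ 0 :=
      Nat.cast_ne_zero.2 (Finset.card_ne_zero_of_mem (Finset.mem_filter.2 ⟨Finset.mem_univ i, hi⟩))
    field_simp

/-- All (partially) symmetric tensors. -/
abbrev allSym (m : ℕ) (d : Fin 3 → ℕ) : Submodule ℂ (Tens m d) :=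
  symTens (fun _ => (⊤ : Submodule ℂ (Fin m → ℂ))) d

theorem power_mem_allSym (x : Point m) : power d x ∈ allSym m d :=
  Submodule.subset_span ⟨x, fun _ => trivial, rfl⟩

theorem dotProduct_eq_of_toPoly_eq {f g : Tens m d} (h : toPoly f = toPoly g) {X : Tens m d}
    (hX : X ∈ allSym m d) : f ⬝ᵥ X = g ⬝ᵥ X := by
  induction hX using Submodule.span_induction with
  | mem X hX =>
    obtain ⟨x, -, rfl⟩ := hX
    rw [← evalAt_toPoly, ← evalAt_toPoly, h]
  | zero => simp
  | add X Y _ _ hX hY => rw [dotProduct_add, dotProduct_add, hX, hY]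
  | smul c X _ hX => rw [dotProduct_smul, dotProduct_smul, hX]

theorem toPoly_eq_zero {f : Tens m d} (h : ∀ x : Point m, f ⬝ᵥ power d x = 0) : toPoly f = 0 := by
  refine MvPolynomial.funext fun x => ?_
  rw [map_zero, ← h fun p k => x (p, k), ← evalAt_toPoly]
  rfl

/-- The standard bilinear form on tensors. -/
noncomputable def pairing (m : ℕ) (d : Fin 3 → ℕ) : LinearMap.BilinForm ℂ (Tens m d) :=
  Matrix.toBilin' 1

theorem pairing_apply (f X : Tens m d) : pairing m d f X = f ⬝ᵥ X := by
  rw [pairing, Matrix.toBilin'_apply', Matrix.one_mulVec]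

theorem pairing_nondegenerate : (pairing m d).Nondegenerate :=
  LinearMap.BilinForm.nondegenerate_toBilin'_of_det_ne_zero' 1 (by simp)

theorem pairing_isRefl : (pairing m d).IsRefl := fun f X h => by
  rw [pairing_apply] at h ⊢
  rwa [dotProduct_comm]

theorem mem_orthogonal {P : Submodule ℂ (Tens m d)} {X : Tens m d} :
    X ∈ (pairing m d).orthogonal P ↔ ∀ f ∈ P, f ⬝ᵥ X = 0 := by
  simp only [LinearMap.BilinForm.mem_orthogonal_iff, pairing_apply]

theorem orthogonal_orthogonal (P : Submodule ℂ (Tens m d)) :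
    (pairing m d).orthogonal ((pairing m d).orthogonal P) = P :=
  LinearMap.BilinForm.orthogonal_orthogonal pairing_nondegenerate pairing_isRefl P

/-- The tensors that represent elements of an ideal. -/
noncomputable def representatives (I : Ideal (CoordRing m)) (d : Fin 3 → ℕ) : Submodule ℂ (Tens m d) :=
  (I.restrictScalars ℂ).comap (toPolyLin m d)

theorem mem_representatives {I : Ideal (CoordRing m)} {f : Tens m d} :
    f ∈ representatives I d ↔ toPoly f ∈ I := Iff.rfl

theorem finrank_representatives (I : Ideal (CoordRing m)) :
    Module.finrank ℂ (representatives I d) =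
      Module.finrank ℂ (idealPart I d) + Module.finrank ℂ (LinearMap.ker (toPolyLin m d)) := by
  have hle : LinearMap.ker (toPolyLin m d) ≤ representatives I d := fun f hf => by
    rw [mem_representatives, ← toPolyLin_apply, LinearMap.mem_ker.1 hf]
    exact I.zero_mem
  have h := LinearMap.finrank_range_add_finrank_ker ((toPolyLin m d).domRestrict (representatives I d))
  have hrange : LinearMap.range ((toPolyLin m d).domRestrict (representatives I d)) =
      idealPart I d := by
    ext g
    constructor
    · rintro ⟨f, rfl⟩
      exact ⟨f.2, toPoly_mem_component _⟩
    · rintro ⟨hgI, hg⟩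
      refine ⟨⟨toSym d g, ?_⟩, toPoly_toSym hg⟩
      rw [mem_representatives, toPoly_toSym hg]
      exact hgI
  have hker : LinearMap.ker ((toPolyLin m d).domRestrict (representatives I d)) =
      (LinearMap.ker (toPolyLin m d)).comap (representatives I d).subtype := rfl
  rw [hrange, hker, (Submodule.comapSubtypeEquivOfLe hle).finrank_eq] at h
  exact h.symm

/-- A tensor orthogonal to all representatives of elements of an ideal is symmetric, as it is
orthogonal to the representatives of zero. -/
theorem perp_eq_orthogonal (I : Ideal (CoordRing m)) (d : Fin 3 → ℕ) :
    perp I d = (pairing m d).orthogonal (representatives I d) := by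
  ext X
  rw [mem_orthogonal]
  constructor
  · exact fun hX f hf => hX.2 f hf
  · refine fun hX => ⟨?_, fun f hf => hX f hf⟩
    change X ∈ allSym m d
    rw [← orthogonal_orthogonal (allSym m d), mem_orthogonal]
    intro f hf
    refine hX f ?_
    rw [mem_orthogonal] at hf
    rw [mem_representatives, toPoly_eq_zero fun x => ?_]
    · exact I.zero_mem
    · rw [dotProduct_comm]
      exact hf _ (power_mem_allSym x)

theorem evalAt_eq_zero_of_mem_pointsIdeal {x : Fin r → Point m} {f : CoordRing m}
    (hf : f ∈ pointsIdeal x) (i : Fin r) : evalAt (x i) f = 0 := by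
  have hle : pointsIdeal x ≤ RingHom.ker (MvPolynomial.eval fun v => x i v.1 v.2) :=
    Ideal.span_le.2 fun g hg => hg.2 i
  exact hle hf

/-- The tensors orthogonal to the powers of the points represent the polynomials that vanish at the
points. -/
theorem orthogonal_span_power (x : Fin r → Point m) (d : Fin 3 → ℕ) :
    (pairing m d).orthogonal (Submodule.span ℂ (Set.range fun i => power d (x i))) =
      representatives (pointsIdeal x) d := by
  ext f
  rw [mem_orthogonal, mem_representatives]
  constructor
  · intro h
    refine Ideal.subset_span ⟨⟨d, toPoly_mem_component f⟩, fun i => ?_⟩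
    rw [evalAt_toPoly, dotProduct_comm]
    exact h _ (Submodule.subset_span ⟨i, rfl⟩)
  · intro h X hX
    induction hX using Submodule.span_induction with
    | mem X hX =>
      obtain ⟨i, rfl⟩ := hX
      rw [dotProduct_comm]
      exact (evalAt_toPoly _ _).symm.trans (evalAt_eq_zero_of_mem_pointsIdeal h i)
    | zero => simp
    | add X Y _ _ hX hY => rw [add_dotProduct, hX, hY, add_zero]
    | smul c X _ hX => rw [smul_dotProduct, hX, smul_zero]

theorem perp_pointsIdeal (x : Fin r → Point m) (d : Fin 3 → ℕ) :
    perp (pointsIdeal x) d = Submodule.span ℂ (Set.range fun i => power d (x i)) := by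
  rw [perp_eq_orthogonal, ← orthogonal_span_power, orthogonal_orthogonal]

/-- As `perp I d` is the orthogonal complement of the representatives, its dimension is determined by
that of the component of the ideal. -/
theorem finrank_perp_eq {I J : Ideal (CoordRing m)}
    (h : Module.finrank ℂ (idealPart I d) = Module.finrank ℂ (idealPart J d)) :
    Module.finrank ℂ (perp I d) = Module.finrank ℂ (perp J d) := by
  rw [perp_eq_orthogonal, perp_eq_orthogonal,
    LinearMap.BilinForm.finrank_orthogonal pairing_nondegenerate,
    LinearMap.BilinForm.finrank_orthogonal pairing_nondegenerate, finrank_representatives,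
    finrank_representatives, h]

end Duality

/-! ### Viable spaces as limits -/

section Viable

variable {m r : ℕ} {d : Fin 3 → ℕ}

/-- The flag of spans of linearly independent powers satisfies the conditions without any limit. -/
theorem exists_secantFlag_span_power (x : Fin r → Point m)
    (hx : LinearIndependent ℂ fun i => power d (x i)) :
    ∃ F W, IsSecantFlag (Submodule.span ℂ (Set.range fun i => power d (x i))) r F W := by
  have hW : ∀ p, ∃ W : ℕ → Submodule ℂ (Fin m → ℂ), IsCompleteFlag ⊤ m W ∧
      ∀ i : Fin r, (i : ℕ) < m → x i p ∈ W (i + 1) := fun p => by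
    obtain ⟨W, hW, hxW⟩ := exists_flag_of_vectors
      fun i : ℕ => if h : i < r then x ⟨i, h⟩ p else 0
    rw [Fintype.card_fin] at hW hxW
    refine ⟨W, hW, fun i hi => ?_⟩
    simpa using hxW i hi
  choose W hW hxW using hW
  refine ⟨frameSpan fun i => power d (x i), W,
    isCompleteFlag_frameSpan hx (fun i => Submodule.subset_span ⟨i, rfl⟩) ?_, hW, ?_, ?_⟩
  · rw [finrank_span_eq_card hx, Fintype.card_fin]
  · intro j hj n t ht
    have h : ∀ l, ∃ c : Fin j → ℂ, ∑ i, c i • power d (x (Fin.castLE hj i)) = t l := fun l => by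
      have := ht l
      rwa [frameSpan_eq_span_range _ hj, Submodule.mem_span_range_iff_exists_fun] at this
    choose c hc using h
    refine subset_closure ⟨fun i => x (Fin.castLE hj i), fun i l => c l i, ?_⟩
    ext l : 1
    rw [Finset.sum_apply]
    exact (hc l).symm
  · intro j hj hjm
    refine frameSpan_le.2 fun i hi => Submodule.subset_span ⟨x i, fun p => ?_, rfl⟩
    exact (hW p).mono hi hjm (hxW p i (hi.trans_le hjm))

/-- A limit of tensors in the spans of the powers of the points is orthogonal to the limit of the
ideals. -/
theorem mem_perp_of_tendsto {I : Ideal (CoordRing m)} {J : ℕ → Ideal (CoordRing m)}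
    (h : GrassmannTendsto (fun n => idealPart (J n) d) (idealPart I d)) {X : ℕ → Tens m d}
    {φ : ℕ → ℕ} (hφ : Tendsto φ atTop atTop) (hX : ∀ n, X n ∈ perp (J (φ n)) d) {Y : Tens m d}
    (hY : Tendsto X atTop (𝓝 Y)) : Y ∈ perp I d := by
  have hsym : Y ∈ allSym m d :=
    (Submodule.closed_of_finiteDimensional (allSym m d)).mem_of_tendsto hY
      (Eventually.of_forall fun n => (hX n).1)
  refine ⟨hsym, fun f hf => ?_⟩
  obtain ⟨g, hg, hlim⟩ := h.2 (toPoly f) ⟨hf, toPoly_mem_component f⟩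
  have h0 : ∀ n, toSym d (g (φ n)) ⬝ᵥ X n = 0 := fun n => (hX n).2 _ <| by
    rw [toPoly_toSym (hg _).2]
    exact (hg _).1
  have hlim' : Tendsto (fun n => toSym d (g (φ n)) ⬝ᵥ X n) atTop
      (𝓝 (toSym d (toPoly f) ⬝ᵥ Y)) := by
    refine tendsto_finsetSum _ fun i _ => ?_
    exact (((hlim _).comp hφ).div_const _).mul ((continuous_apply i).continuousAt.tendsto.comp hY)
  simp only [h0] at hlim'
  change f ⬝ᵥ Y = 0
  rw [← tendsto_nhds_unique hlim' tendsto_const_nhds]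
  exact dotProduct_eq_of_toPoly_eq (toPoly_toSym (toPoly_mem_component f)).symm hsym

/-- A viable space has a flag as in `IsSecantFlag`: a limit of the flags of spans of the powers of
the points. -/
theorem IsViable.exists_secantFrames {T : Tens m ![1, 1, 1]} {E : Submodule ℂ (Tens m d)}
    (hE : IsViable r T d E) : ∃ y ∈ secantFrames m r d, ∀ i, y.1 i ∈ E := by
  obtain ⟨hr, I, ⟨-, x, -, -, hlim⟩, rfl⟩ := hE
  obtain ⟨n₀, hn₀⟩ := eventually_atTop.1 (hlim d).1
  have hframe : ∀ n, ∃ y ∈ secantFrames m r d, ∀ i, y.1 i ∈ perp (pointsIdeal (x (n₀ + n))) d := by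
    intro n
    -- The span of the `r` powers has dimension `r`, so that they are linearly independent.
    have hrank := finrank_perp_eq (hn₀ (n₀ + n) (Nat.le_add_right _ _))
    rw [hr, perp_pointsIdeal] at hrank
    have hli : LinearIndependent ℂ fun i => power d (x (n₀ + n) i) := by
      rw [linearIndependent_iff_card_eq_finrank_span, Fintype.card_fin]
      exact hrank.symm
    obtain ⟨F, W, hFW⟩ := exists_secantFlag_span_power _ hli
    obtain ⟨y, hy, hyE, -⟩ := hFW.exists_frames
    exact ⟨y, hy, by rwa [perp_pointsIdeal]⟩
  choose y hy hyE using hframe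
  obtain ⟨z, hz, φ, hφ, hzlim⟩ := isCompact_secantFrames.tendsto_subseq hy
  refine ⟨z, hz, fun i => ?_⟩
  refine mem_perp_of_tendsto (hlim d) (φ := fun n => n₀ + φ n) (X := fun n => (y (φ n)).1 i)
    (tendsto_atTop_mono (fun n => Nat.le_add_left _ _) hφ.tendsto_atTop) (fun n => hyE (φ n) i) ?_
  exact (((continuous_apply i).comp continuous_fst).tendsto z).comp hzlim

theorem closure_subset_zariskiClosure {ι : Type} [Fintype ι] (S : Set (ι → ℂ)) :
    closure S ⊆ zariskiClosure S := by
  intro v hv f hf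
  have hclosed : IsClosed {w : ι → ℂ | MvPolynomial.eval w f = 0} :=
    isClosed_eq (MvPolynomial.continuous_eval f) continuous_const
  exact closure_minimal (fun w hw => hf w hw) hclosed hv

theorem IsSecantFlag.subset_secantCone {E : Submodule ℂ (Tens m d)}
    {F : ℕ → Submodule ℂ (Tens m d)} {W : Fin 3 → ℕ → Submodule ℂ (Fin m → ℂ)}
    (h : IsSecantFlag E r F W) {j : ℕ} (hj : j ≤ r) :
    (F j : Set (Tens m d)) ⊆ secantCone (segreVeroneseCone m d) j := by
  intro X hX
  refine closure_subset_zariskiClosure _ ?_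
  have h1 := h.secant j hj 1 (fun _ => X) fun _ => hX
  refine map_mem_closure (continuous_apply (0 : Fin 1)) h1 ?_
  rintro _ ⟨x, c, rfl⟩
  exact ⟨fun i => c i 0 • power d (x i), fun i => ⟨_, _, rfl⟩, by simp⟩

end Viable

end FlagCond

open FlagCond in
theorem proposition2p5 (m r : ℕ) (T : Tens m ![1, 1, 1]) (BT : Subgroup (GL3 m))
    (hBT : IsBorelSubgroup (symmetryGroup T) BT) :
    (∀ E : Submodule ℂ (Tens m ![1, 1, 0]), IsViable r T ![1, 1, 0] E →
      ∃ F : ℕ → Submodule ℂ (Tens m ![1, 1, 0]),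
        IsCompleteFlag E r F ∧
        (IsFixed BT E → ∀ j ≤ r, IsFixed BT (F j)) ∧
        ∀ j, 1 ≤ j → j ≤ r →
          (F j : Set (Tens m ![1, 1, 0])) ⊆ secantCone (segreVeroneseCone m ![1, 1, 0]) j ∧
          ∀ t : Fin j → Tens m ![1, 1, 0],
            Submodule.span ℂ (Set.range t) = F j → BorderRankLE t j) ∧
    (∀ (d : Fin 3 → ℕ) (E : Submodule ℂ (Tens m d)), IsViable r T d E →
      ∃ (F : ℕ → Submodule ℂ (Tens m d)) (W : Fin 3 → ℕ → Submodule ℂ (Fin m → ℂ)),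
        IsCompleteFlag E r F ∧
        (IsFixed BT E → ∀ j ≤ r, IsFixed BT (F j)) ∧
        (∀ p, IsCompleteFlag (⊤ : Submodule ℂ (Fin m → ℂ)) m (W p)) ∧
        (∀ j, 1 ≤ j → j ≤ r →
          (F j : Set (Tens m d)) ⊆ secantCone (segreVeroneseCone m d) j) ∧
        ∀ j, 1 ≤ j → j ≤ r → j ≤ m → F j ≤ symTens (fun p => W p j) d) := by
  obtain ⟨-, hclosed, hconn, hsolv⟩ := hBT.1
  refine ⟨fun E hE => ?_, fun d E hE => ?_⟩
  · obtain ⟨F, W, hFW, hfix⟩ :=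
      exists_fixed_secantFlag hE.1 hE.exists_secantFrames hclosed hconn hsolv
    refine ⟨F, hFW.flag, hfix, fun j _ hj => ⟨hFW.subset_secantCone hj, fun t ht => ?_⟩⟩
    exact hFW.secant j hj j t fun l => ht ▸ Submodule.subset_span ⟨l, rfl⟩
  · obtain ⟨F, W, hFW, hfix⟩ :=
      exists_fixed_secantFlag hE.1 hE.exists_secantFrames hclosed hconn hsolv
    exact ⟨F, W, hFW.flag, hfix, hFW.flags, fun j _ hj => hFW.subset_secantCone hj,
      fun j _ hj hjm => hFW.sym j hj hjm⟩
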